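/- **Setting.** Let $\phi$ be the coordinatewise ReLU. A fully connected network with $d\ge 2$ layers and widths $h_0,\dots,h_d$ has parameters $\theta=(A_1,\dots,A_d)$, $A_i\in\mathbb R^{h_i\times h_{i-1}}$; on input $x=x^0$ it computes $x^1=A_1x^0$, $x^i=A_i\phi(x^{i-1})$ $(2\le i\le d)$ and $f_\theta(x)=x^d$. For $i\le j$ let $M^{i,j}$ be the map $x^i\mapsto x^j$ and $J^{i,j}_{x^i}$ its Jacobian at $x^i$. Let $h_{\min}=\min_{1\le i\le d-1}h_i$. Fix a finite non-empty sample $S$ of pairs $(x,y)$, and let $L(f)=\frac1{|S|}\sum_{(x,y)\in S}l(y,f(x))$, where $l(y,\cdot)$ is convex and $\beta$-Lipschitz for every $y$. Norms are Euclidean norms of vectors and operator norms of matrices; $\|\cdot\|_F$ is the Frobenius norm and $[A]_j$ the $j$-th column of $A$. *Dropout* with probability $p$ multiplies every column of every matrix $A_2,\dots,A_d$ by independent factors, equal to $0$ with probability $p$ and to $\frac1{1-p}$ with probability $1-p$; this gives $\hat A_2,\dots,\hat A_d$. Put $\theta^i=(A_1,\hat A_2,\dots,\hat A_i,A_{i+1},\dots,A_d)$,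 and let $\hat x^i_q(t)$ be the vector before activation at layer $i$ computed with the parameters $t\theta+(1-t)\theta^q$. *Noise stability quantities* (minima and maxima over the inputs $x$ of $S$): $$\mu_i=\min_x\frac{\|A_i\phi(x^{i-1})\|}{\|A_i\|_F\|\phi(x^{i-1})\|},\quad \mu_{i\to}=\min_{i\le j\le d}\min_x\frac{\|J^{i,j}_{x^i}x^i\|}{\|J^{i,j}_{x^i}\|\|x^i\|},\quad c=\max_{x,\,1\le i\le d-1}\frac{\|x^i\|}{\|\phi(x^i)\|}.$$ Given a width bound $W$ and a constant $K_1$, the network $\theta$ is *$\epsilon$-noise stable* (for dropout probability $p$) if $h_{\min}\ge W$; if $\mu_i\mu_{i\to}>0$ for $2\le i\le d$; if there is $\rho\ge 3d$ such that with probability at least $\frac12$ over the dropout the following two properties hold: - for all $2\le i\le j\le d$, $x$ in $S$, $t\in[0,1]$ and $q\in\{i,i-1\}$, $\|M^{i,j}(\hat x^i_q(t))-J^{i,j}_{x^i}\hat x^i_q(t)\|\le\frac{\|\hat x^i_q(t)-x^i\|\,\|x^j\|}{\rho\|x^i\|}$; - for all $1\le i\le d-1$, $x$ in $S$ and $t\in[0,1]$,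 $\|\phi(\hat x^i_i(t))\|_\infty\le\frac{K_1}{\sqrt{h_i}}\|\phi(\hat x^i_i(t))\|$; and if $$\frac{\beta\,c\,d^{3/2}\max_{x}\|f_\theta(x)\|}{h_{\min}^{1/2}\min_{2\le i\le d}(\mu_i\mu_{i\to})}\le\epsilon .$$ Finally let $\Lambda(\theta)=\log\bigl(2+|S|+d+\beta+\max_{x}\|x\|+\tfrac1\epsilon+\sum_{i=1}^d(h_i+\|A_i\|)\bigr)$ (with $\frac1\epsilon$ read as $0$ if $\epsilon=0$). **Theorem.** For all $K_1,K_2>0$ there are constants $C_0,C>0$ and $k_0,k\in\mathbb N$, depending only on $K_1,K_2$, such that the following holds for all data as above. Put $W=C_0\log^{k_0}(d+1)$. Let $\theta^*$ be a network with $d$ layers, widths $h_i^*$, the same input and output dimensions $h_0^*=h_0$, $h_d^*=h_d$, and $\min_{1\le i\le d-1}h_i^*\ge W$. Let $p$ satisfy $1.5\max_{1\le i\le d-1}(h_i^*/h_i)\le p\le\frac34$. Let $\theta^A,\theta^B$ be two networks with widths $h_0,\dots,h_d$ that are $\epsilon$-noise stable for dropout probability $p$ (with width bound $W$ and constant $K_1$),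 and suppose that the weight matrices $A_i$ of each of them satisfy $\|[A_i]_j\|\le K_2\sqrt p\,\|A_i\|_F$ for $2\le i\le d$, $1\le j\le h_{i-1}$. Then there is a continuous path $\pi:[0,1]\to\mathbb R^{h_1\times h_0}\times\cdots\times\mathbb R^{h_d\times h_{d-1}}$ from $\theta^A$ to $\theta^B$, consisting of 13 line segments, such that for all $t\in[0,1]$ $$L(f_{\pi(t)})\le\max\bigl\{L(f_{\theta^A})+C\Lambda(\theta^A)^k\sqrt p\,\epsilon,\ L(f_{\theta^B})+C\Lambda(\theta^B)^k\sqrt p\,\epsilon,\ L(f_{\theta^*})\bigr\}.$$ -/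

import Mathlib

open MeasureTheory Set

noncomputable section

namespace DeepNet

/-- Euclidean space of dimension `n` (with the `ℓ²` norm). -/
abbrev E (n : ℕ) : Type := EuclideanSpace ℝ (Fin n)

/-- Coordinatewise ReLU activation `φ`. -/
def relu {n : ℕ} (v : E n) : E n := WithLp.toLp 2 fun j => max (v j) 0

/-- The parameter space of fully connected networks with `d` layers and widths
`h 0, h 1, …, h d` (`h 0` is the input dimension and `h d` the output dimension; other values of
`h` play no role). For `k : Fin d`, `θ k` is the weight matrix of layer `k + 1`. -/
abbrev Params (d : ℕ) (h : ℕ → ℕ) : Type :=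
  (k : Fin d) → Matrix (Fin (h (k + 1))) (Fin (h k)) ℝ

/-- Matrix-vector product in Euclidean spaces. -/
def mulE {n m : ℕ} (A : Matrix (Fin m) (Fin n) ℝ) (v : E n) : E m :=
  WithLp.toLp 2 (A.mulVec v.ofLp)

/-- What layer `k + 1` does to the vector `x^k` before its matrix is applied: nothing to the
input `x^0`, and ReLU for `k ≥ 1`. -/
def act {n : ℕ} : ℕ → E n → E n
  | 0, v => v
  | _ + 1, v => relu v

/-- Layer `k + 1` as a map from the pre-activation vector `x^k` to `x^(k+1)`, for `k < d`. -/
def layer {d : ℕ} {h : ℕ → ℕ} (θ : Params d h) (k : ℕ) (v : E (h k)) : E (h (k + 1)) :=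
  if hk : k < d then mulE (θ ⟨k, hk⟩) (act k v) else 0

/-- The vector `x^k` before activation at layer `k` on input `x`, with `x^0 = x`. -/
def pre {d : ℕ} {h : ℕ → ℕ} (θ : Params d h) (x : E (h 0)) : (k : ℕ) → E (h k)
  | 0 => x
  | k + 1 => layer θ k (pre θ x k)

/-- The function `f_θ` computed by the network. -/
def net {d : ℕ} {h : ℕ → ℕ} (θ : Params d h) (x : E (h 0)) : E (h d) := pre θ x d

/-- The operator `M^{i,i+n}` that maps the pre-activation vector of layer `i` to that of layer
`i + n`. -/
def comp {d : ℕ} {h : ℕ → ℕ} (θ : Params d h) (i : ℕ) : (n : ℕ) → E (h i) → E (h (i + n))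
  | 0, v => v
  | n + 1, v => layer θ (i + n) (comp θ i n v)

/-- The Jacobian `J^{i,i+n}_{x^i}` of `M^{i,i+n}` at the vector `x^i` computed from `x`. -/
def jac {d : ℕ} {h : ℕ → ℕ} (θ : Params d h) (x : E (h 0)) (i n : ℕ) :
    E (h i) →L[ℝ] E (h (i + n)) :=
  fderiv ℝ (comp θ i n) (pre θ x i)

/-- The empirical loss of a predictor `f` on the sample `(X s, Y s)`, `s : Fin m`. -/
def empLoss {m a b : ℕ} (l : E b → E b → ℝ) (X : Fin m → E a) (Y : Fin m → E b)
    (f : E a → E b) : ℝ :=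
  (1 / (m : ℝ)) * ∑ s, l (Y s) (f (X s))

/-- Identification of Euclidean spaces of equal dimension. -/
def castE {a b : ℕ} (e : a = b) (v : E a) : E b := WithLp.toLp 2 fun j => v (Fin.cast e.symm j)

/-- Minimum width `h_min` of the hidden layers `1, …, d - 1`. -/
def minWidth (d : ℕ) (h : ℕ → ℕ) : ℕ := ⨅ k : Fin (d - 1), h (k + 1)

/-- Frobenius norm. -/
def frob {n m : ℕ} (A : Matrix (Fin m) (Fin n) ℝ) : ℝ := √(∑ i, ∑ j, A i j ^ 2)

/-- Euclidean norm of the `j`-th column. -/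
def colNorm {n m : ℕ} (A : Matrix (Fin m) (Fin n) ℝ) (j : Fin n) : ℝ := √(∑ i, A i j ^ 2)

/-- Operator (spectral) norm. -/
def opNorm {n m : ℕ} (A : Matrix (Fin m) (Fin n) ℝ) : ℝ :=
  ‖LinearMap.toContinuousLinearMap (Matrix.toLpLin 2 2 A)‖

/-! ### Dropout -/

/-- The sample space of dropout: one bit for every column of every weight matrix, `true` meaning
that the column is dropped. -/
abbrev Mask (d : ℕ) (h : ℕ → ℕ) : Type := ((k : Fin d) × Fin (h k)) → Bool

/-- The law of one bit: `true` with probability `p`, `false` with probability `1 - p`. -/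
def bitLaw (p : ℝ) : Measure Bool :=
  ENNReal.ofReal p • Measure.dirac true + ENNReal.ofReal (1 - p) • Measure.dirac false

instance (p : ℝ) : IsFiniteMeasure (bitLaw p) := by
  refine ⟨?_⟩
  simp [bitLaw]

/-- The law of the dropout mask: independent bits. -/
def maskLaw (d : ℕ) (h : ℕ → ℕ) (p : ℝ) : Measure (Mask d h) := Measure.pi fun _ => bitLaw p

/-- The dropped-out weight matrix of layer `k + 1`: column `j` is multiplied by `0` if it is
dropped and by `1 / (1 - p)` otherwise. -/
def dropLayer {d : ℕ} {h : ℕ → ℕ} (p : ℝ) (θ : Params d h) (ω : Mask d h) (k : Fin d) :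
    Matrix (Fin (h (k + 1))) (Fin (h k)) ℝ :=
  Matrix.of fun r j => (if ω ⟨k, j⟩ then 0 else 1 / (1 - p)) * θ k r j

/-- The network `θ^i`, in which the layers `2, …, i` are dropped out. -/
def dropUpTo {d : ℕ} {h : ℕ → ℕ} (p : ℝ) (θ : Params d h) (ω : Mask d h) (i : ℕ) : Params d h :=
  fun k => if 2 ≤ (k : ℕ) + 1 ∧ (k : ℕ) + 1 ≤ i then dropLayer p θ ω k else θ k

/-- The vector `x̂^i_q(t)` before activation at layer `i`, computed with the parameters
`t θ + (1 - t) θ^q`. -/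
def hatX {d : ℕ} {h : ℕ → ℕ} (p : ℝ) (θ : Params d h) (ω : Mask d h) (x : E (h 0))
    (i q : ℕ) (t : ℝ) : E (h i) :=
  pre (t • θ + (1 - t) • dropUpTo p θ ω q) x i

/-! ### Noise stability -/

/-- The layer cushion of layer `k + 1` (for `k ≥ 1`). -/
def layerCushion {d m : ℕ} {h : ℕ → ℕ} (θ : Params d h) (X : Fin m → E (h 0)) (k : Fin d) : ℝ :=
  ⨅ s, ‖mulE (θ k) (relu (pre θ (X s) k))‖ / (frob (θ k) * ‖relu (pre θ (X s) k)‖)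

/-- The interlayer cushion `μ_{i,i+n}`. -/
def interlayerCushion {d m : ℕ} {h : ℕ → ℕ} (θ : Params d h) (X : Fin m → E (h 0))
    (i n : ℕ) : ℝ :=
  ⨅ s, ‖jac θ (X s) i n (pre θ (X s) i)‖ / (‖jac θ (X s) i n‖ * ‖pre θ (X s) i‖)

/-- The minimal interlayer cushion of layer `i ≤ d`: the minimum of `μ_{i,j}` over
`i ≤ j ≤ d`. -/
def minInterlayerCushion {d m : ℕ} {h : ℕ → ℕ} (θ : Params d h) (X : Fin m → E (h 0))
    (i : ℕ) : ℝ :=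
  ⨅ n : Fin (d - i + 1), interlayerCushion θ X i n

/-- The minimum over the layers `2 ≤ i ≤ d` of (layer cushion) times (minimal interlayer
cushion); here `i = k + 2`. -/
def minCushion {d m : ℕ} {h : ℕ → ℕ} (θ : Params d h) (X : Fin m → E (h 0)) : ℝ :=
  ⨅ k : Fin (d - 1),
    layerCushion θ X ⟨k + 1, by omega⟩ * minInterlayerCushion θ X (k + 2)

/-- The activation contraction `c`, a maximum over the sample and the hidden layers. -/
def actContraction {d m : ℕ} {h : ℕ → ℕ} (θ : Params d h) (X : Fin m → E (h 0)) : ℝ :=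
  ⨆ z : Fin m × Fin (d - 1),
    ‖pre θ (X z.1) (z.2 + 1)‖ / ‖relu (pre θ (X z.1) (z.2 + 1))‖

/-- The interlayer smoothness inequalities with parameter `ρ`, for the outcome `ω` of dropout. -/
def SmoothAt {d m : ℕ} {h : ℕ → ℕ} (p ρ : ℝ) (θ : Params d h) (X : Fin m → E (h 0))
    (ω : Mask d h) : Prop :=
  ∀ i n : ℕ, 2 ≤ i → i + n ≤ d → ∀ s : Fin m, ∀ t ∈ Icc (0 : ℝ) 1, ∀ q : ℕ,
    (q = i ∨ q = i - 1) →
    ‖comp θ i n (hatX p θ ω (X s) i q t) - jac θ (X s) i n (hatX p θ ω (X s) i q t)‖ ≤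
      ‖hatX p θ ω (X s) i q t - pre θ (X s) i‖ * ‖pre θ (X s) (i + n)‖ /
        (ρ * ‖pre θ (X s) i‖)

/-- Flatness of the hidden activations with constant `K`, for the outcome `ω` of dropout:
`‖φ(x̂^i_i(t))‖_∞ ≤ (K / √h_i) ‖φ(x̂^i_i(t))‖`. -/
def FlatAt {d m : ℕ} {h : ℕ → ℕ} (p K : ℝ) (θ : Params d h) (X : Fin m → E (h 0))
    (ω : Mask d h) : Prop :=
  ∀ i : ℕ, 1 ≤ i → i ≤ d - 1 → ∀ s : Fin m, ∀ t ∈ Icc (0 : ℝ) 1, ∀ j : Fin (h i),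
    |relu (hatX p θ ω (X s) i i t) j| ≤
      K / √(h i) * ‖relu (hatX p θ ω (X s) i i t)‖

/-- The number `β c d^{3/2} max ‖f_θ(x)‖ / (h_min^{1/2} min_i (μ_i μ_{i→}))`. -/
def stabilityNumber {d m : ℕ} {h : ℕ → ℕ} (β : ℝ) (θ : Params d h) (X : Fin m → E (h 0)) : ℝ :=
  β * actContraction θ X * (d : ℝ) ^ (3 / 2 : ℝ) * (⨆ s, ‖net θ (X s)‖) /
    (√(minWidth d h) * minCushion θ X)

/-- `ε`-noise stability under dropout with probability `p`. `W` is the lower bound on the width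
and `K` the constant of the flatness condition. Positivity of the cushions says that the
quotients that define them, and `ε`, are meaningful and that `ε` is finite. -/
structure NoiseStable {d m : ℕ} {h : ℕ → ℕ} (W K p β ε : ℝ) (θ : Params d h)
    (X : Fin m → E (h 0)) : Prop where
  width : W ≤ minWidth d h
  cushion_pos : 0 < minCushion θ X
  smooth_flat : ∃ ρ : ℝ, 3 * (d : ℝ) ≤ ρ ∧
    1 / 2 ≤ maskLaw d h p {ω | SmoothAt p ρ θ X ω ∧ FlatAt p K θ X ω}
  number_le : stabilityNumber β θ X ≤ ε

/-- The logarithmic quantity whose powers are suppressed in the error bound: the logarithm of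
the sample size, the depth, the Lipschitz constant, the norms of the inputs, `1 / ε`, the widths
and the norms of the weight matrices. -/
def logFactor {d m : ℕ} {h : ℕ → ℕ} (β ε : ℝ) (θ : Params d h) (X : Fin m → E (h 0)) : ℝ :=
  Real.log (2 + m + d + β + (⨆ s, ‖X s‖) + 1 / ε + ∑ k : Fin d, ((h (k + 1) : ℝ) + opNorm (θ k)))

/-- A path that consists of `n` line segments (possibly constant ones). -/
def HasSegments {V : Type*} [TopologicalSpace V] [AddCommGroup V] [Module ℝ V] {a b : V}
    (n : ℕ) (γ : Path a b) : Prop :=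
  ∃ τ : Fin (n + 1) → ℝ, StrictMono τ ∧ τ 0 = 0 ∧ τ (Fin.last n) = 1 ∧
    ∀ k : Fin n, ∀ u ∈ Icc (0 : ℝ) 1,
      γ.extend ((1 - u) * τ k.castSucc + u * τ k.succ) =
        (1 - u) • γ.extend (τ k.castSucc) + u • γ.extend (τ k.succ)

end DeepNet

end

open MeasureTheory Set

noncomputable section

namespace DeepNet

/-! ### Forward passes: agreement of networks, affinity in the last layer, homogeneity -/

section Basic

/-! The proof has a probabilistic and a deterministic half, joined by the notion of a dead neuron:
one whose outgoing weights vanish.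

Probabilistic half (`exists_dead`): some outcome of dropout kills at least $h_k^*$ neurons in every
hidden layer $k$ and barely changes the outputs along the whole segment to the dropped-out network.
Passing the noisy vectors of successive layers through the clean network gives a telescoping sum. By
interlayer smoothness it is, up to a small error, the sum of the Jacobians applied to the noise of
each layer (`norm_pre_sub_le`). This sum is a vector-valued martingale over the layers: given the
earlier bits, the noise of a layer is a sum of independent centred columns. Flatness, column balance
and the cushions bound the increments (`cushion_bounds`, `prob_noise_le`). The potential
$\exp\sqrt{1+\|v\|^2}$ yields an exponential tail without any dimension factor (`prob_norm_ge_le`).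
A union bound covers inputs, layers and a grid in $t$, and Lipschitz continuity fills the grid. The
grid has $e^{O(d\Lambda)}$ points, so deviations of order $d\Lambda$ must be allowed; the factor
$d^{3/2}\ge d$ in the stability number pays for this. A Chernoff bound controls the number of
dropped neurons. The failures have total probability at most $3/8$, whereas the stability event has
probability at least $1/2$, so a good outcome exists.

Deterministic half (`exists_path_of_dead`): dead neurons can receive a copy of $\theta^*$ without
changing the output. Replacing the last matrix then switches from the old network to $\theta^*$,
with loss controlled by convexity, and the old neurons can be erased (`exists_to_emb`). Both ends
are thus joined to copies of $\theta^*$ in different places. The two copies are connected by writing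
$\theta^*$ in both places, moving the reading from one to the other and erasing the first; the
computed function stays that of $\theta^*$ throughout. -/

theorem mulE_apply {n m : ℕ} (A : Matrix (Fin m) (Fin n) ℝ) (v : E n) (r : Fin m) :
    mulE A v r = ∑ j, A r j * v j := rfl

theorem relu_apply {n : ℕ} (v : E n) (j : Fin n) : relu v j = max (v j) 0 := rfl

theorem mulE_mul {n m q : ℕ} (A : Matrix (Fin m) (Fin n) ℝ) (B : Matrix (Fin n) (Fin q) ℝ)
    (v : E q) : mulE (A * B) v = mulE A (mulE B v) := by
  simp [mulE, Matrix.mulVec_mulVec]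

theorem mulE_add_left {n m : ℕ} (A B : Matrix (Fin m) (Fin n) ℝ) (v : E n) :
    mulE (A + B) v = mulE A v + mulE B v := by
  simp [mulE, Matrix.add_mulVec]

theorem mulE_smul_left {n m : ℕ} (a : ℝ) (A : Matrix (Fin m) (Fin n) ℝ) (v : E n) :
    mulE (a • A) v = a • mulE A v := by
  simp [mulE, Matrix.smul_mulVec]

theorem mulE_smul_right {n m : ℕ} (a : ℝ) (A : Matrix (Fin m) (Fin n) ℝ) (v : E n) :
    mulE A (a • v) = a • mulE A v := by
  simp [mulE, Matrix.mulVec_smul]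

theorem mulE_one {n : ℕ} (v : E n) : mulE (1 : Matrix (Fin n) (Fin n) ℝ) v = v := by
  simp [mulE]

variable {d : ℕ} {h : ℕ → ℕ}

theorem layer_of_lt (θ : Params d h) {k : ℕ} (hk : k < d) (v : E (h k)) :
    layer θ k v = mulE (θ ⟨k, hk⟩) (act k v) := by
  simp [layer, hk]

theorem pre_succ (θ : Params d h) (x : E (h 0)) {k : ℕ} (hk : k < d) :
    pre θ x (k + 1) = mulE (θ ⟨k, hk⟩) (act k (pre θ x k)) := layer_of_lt θ hk _

theorem act_of_pos {n k : ℕ} (hk : 1 ≤ k) (v : E n) : act k v = relu v := by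
  cases k with
  | zero => omega
  | succ k => rfl

theorem act_congr {n k : ℕ} {v w : E n} {j : Fin n} (hj : v j = w j) : act k v j = act k w j := by
  cases k with
  | zero => exact hj
  | succ k => simp [act, relu_apply, hj]

/-- Networks whose weight matrices agree below layer `i` compute the same vector at layer `i`. -/
theorem pre_congr {θ θ' : Params d h} (x : E (h 0)) {i : ℕ}
    (H : ∀ k : Fin d, (k : ℕ) < i → θ k = θ' k) : pre θ x i = pre θ' x i := by
  induction i with
  | zero => rfl
  | succ i ih =>
    have := ih fun k hk => H k (by omega)
    by_cases hi : i < d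
    · rw [pre_succ θ x hi, pre_succ θ' x hi, this, H ⟨i, hi⟩ (by simp)]
    · simp [pre, layer, hi]

/-- If two networks have the same rows outside of the sets `D` of neurons, and these rows do not
read neurons of `D`, then they agree outside of `D`. -/
theorem pre_eq_off {θ θ' : Params d h} (x : E (h 0)) (D : ∀ k, Set (Fin (h k)))
    (hrow : ∀ k : Fin d, ∀ r ∉ D (k + 1), ∀ j, θ k r j = θ' k r j)
    (hzero : ∀ k : Fin d, ∀ r ∉ D (k + 1), ∀ j ∈ D k, θ k r j = 0) {k : ℕ} (hk : k ≤ d)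
    {r : Fin (h k)} (hr : r ∉ D k) : pre θ x k r = pre θ' x k r := by
  induction k with
  | zero => rfl
  | succ k ih =>
    have hk' : k < d := hk
    rw [pre_succ θ x hk', pre_succ θ' x hk', mulE_apply, mulE_apply]
    refine Finset.sum_congr rfl fun j _ => ?_
    by_cases hj : j ∈ D k
    · rw [← hrow ⟨k, hk'⟩ r hr j, hzero ⟨k, hk'⟩ r hr j hj]; simp
    · rw [hrow ⟨k, hk'⟩ r hr j, act_congr (ih hk'.le hj)]

theorem net_eq_of_off {θ θ' : Params d h} (x : E (h 0)) (D : ∀ k, Set (Fin (h k)))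
    (hDd : D d = ∅)
    (hrow : ∀ k : Fin d, ∀ r ∉ D (k + 1), ∀ j, θ k r j = θ' k r j)
    (hzero : ∀ k : Fin d, ∀ r ∉ D (k + 1), ∀ j ∈ D k, θ k r j = 0) :
    net θ x = net θ' x := by
  ext r
  exact pre_eq_off x D hrow hzero le_rfl (by simp [hDd])

/-- The network depends on its last weight matrix in an affine way. -/
theorem net_affine_last {θ θ' : Params d h} (x : E (h 0))
    (H : ∀ k : Fin d, (k : ℕ) + 1 < d → θ k = θ' k) (hd : 1 ≤ d) (u : ℝ) :
    net ((1 - u) • θ + u • θ') x = (1 - u) • net θ x + u • net θ' x := by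
  obtain ⟨d, rfl⟩ : ∃ e, d = e + 1 := ⟨d - 1, by omega⟩
  have h1 : pre ((1 - u) • θ + u • θ') x d = pre θ x d := pre_congr x fun k hk => by
    simp only [Pi.add_apply, Pi.smul_apply, ← H k (by omega), ← add_smul]
    simp
  have h2 : pre θ' x d = pre θ x d := pre_congr x fun k hk => (H k (by omega)).symm
  simp only [net, pre_succ _ x (Nat.lt_succ_self d), h1, h2, Pi.add_apply, Pi.smul_apply,
    mulE_add_left, mulE_smul_left]

theorem relu_smul {n : ℕ} {a : ℝ} (ha : 0 ≤ a) (v : E n) : relu (a • v) = a • relu v := by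
  ext j
  simp only [relu_apply, PiLp.smul_apply, smul_eq_mul]
  rw [mul_max_of_nonneg _ _ ha, mul_zero]

theorem act_smul {n k : ℕ} {a : ℝ} (ha : 0 ≤ a) (v : E n) : act k (a • v) = a • act k v := by
  cases k with
  | zero => rfl
  | succ k => exact relu_smul ha v

/-- Scaling all weights towards zero only shrinks the output. This settles the case in which the
allowed error exceeds the size of the outputs. -/
theorem pre_smul (θ : Params d h) (x : E (h 0)) {a : ℝ} (ha : 0 ≤ a) {k : ℕ} (hk : k ≤ d) :
    pre (a • θ) x k = a ^ k • pre θ x k := by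
  induction k with
  | zero => simp [pre]
  | succ k ih =>
    rw [pre_succ _ x hk, pre_succ _ x hk, ih (by omega), act_smul (pow_nonneg ha k),
      mulE_smul_right, Pi.smul_apply, mulE_smul_left, smul_smul, pow_succ]

end Basic

/-! ### Copies of a small network inside a wide one -/

section Embedding

variable {d : ℕ} {h hstar : ℕ → ℕ}

/-- The network that writes the neurons of `θ` at the places described by `α` and reads them at
the places described by `β`. -/
def emb (α β : ∀ k, Matrix (Fin (h k)) (Fin (hstar k)) ℝ) (θ : Params d hstar) : Params d h :=
  fun k => α (k + 1) * θ k * (β k).transpose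

/-- In each hidden layer a copy only has to recover its activations after writing, ReLU and reading.
Places of writing and of reading may therefore be varied in all layers at once. -/
theorem net_emb {α β : ∀ k, Matrix (Fin (h k)) (Fin (hstar k)) ℝ} {θ : Params d hstar}
    (hin : hstar 0 = h 0) (hout : hstar d = h d) (hd : 1 ≤ d)
    (h0 : ∀ x, mulE (β 0).transpose x = castE hin.symm x)
    (hmid : ∀ k, 1 ≤ k → k < d → ∀ v, mulE (β k).transpose (relu (mulE (α k) v)) = relu v)
    (hlast : ∀ v, mulE (α d) v = castE hout v) (x : E (h 0)) :
    net (emb α β θ) x = castE hout (net θ (castE hin.symm x)) := by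
  have key : ∀ k, 1 ≤ k → k ≤ d →
      pre (emb α β θ) x k = mulE (α k) (pre θ (castE hin.symm x) k) := by
    intro k hk
    induction k, hk using Nat.le_induction with
    | base =>
      intro hkd
      rw [pre_succ _ x hkd, pre_succ _ _ hkd]
      simp only [emb, mulE_mul]
      show mulE _ (mulE _ (mulE _ x)) = mulE _ (mulE _ (castE hin.symm x))
      rw [← h0]
    | succ k hk ih =>
      intro hkd
      rw [pre_succ _ x hkd, pre_succ _ _ hkd, ih (by omega)]
      simp only [emb, mulE_mul, act_of_pos hk]
      rw [hmid k hk hkd]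
  rw [net, key d hd le_rfl, hlast, net]

/-- The matrix of the identification of neurons with equal numbers. -/
def castMat (a b : ℕ) : Matrix (Fin a) (Fin b) ℝ :=
  Matrix.of fun r j => if (r : ℕ) = j then 1 else 0

theorem mulE_castMat {a b : ℕ} (e : b = a) (v : E b) : mulE (castMat a b) v = castE e v := by
  subst e
  ext r
  simp [mulE_apply, castMat, castE, Fin.val_inj]

theorem castMat_transpose (a b : ℕ) : (castMat a b).transpose = castMat b a := by
  ext r j
  simp [castMat, eq_comm]

/-- A nonnegative matrix with at most one nonzero entry per row commutes with ReLU, so the reading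
matrix only needs to be its left inverse. -/
theorem mulE_relu_mulE {a b : ℕ} {α β : Matrix (Fin a) (Fin b) ℝ} (hpos : ∀ r j, 0 ≤ α r j)
    (huniq : ∀ r j j', α r j ≠ 0 → α r j' ≠ 0 → j = j') (hone : β.transpose * α = 1) (v : E b) :
    mulE β.transpose (relu (mulE α v)) = relu v := by
  have : relu (mulE α v) = mulE α (relu v) := by
    ext r
    simp only [relu_apply, mulE_apply]
    by_cases H : ∃ j, α r j ≠ 0
    · obtain ⟨j, hj⟩ := H
      have h0 : ∀ j' ≠ j, α r j' = 0 := fun j' hj' => by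
        by_contra h
        exact hj' (huniq r j' j h hj)
      rw [Finset.sum_eq_single j (by intro j' _ hj'; simp [h0 j' hj']) (by simp),
        Finset.sum_eq_single j (by intro j' _ hj'; simp [h0 j' hj']) (by simp),
        mul_max_of_nonneg _ _ (hpos r j), mul_zero]
    · push Not at H
      simp [H]
  rw [this, ← mulE_mul, hone, mulE_one]

/-- The `0`-`1` matrix of an injection of neurons. -/
def indMat {a b : ℕ} (σ : Fin b → Fin a) : Matrix (Fin a) (Fin b) ℝ :=
  Matrix.of fun r j => if r = σ j then 1 else 0

/-- The `0`-`1` matrix of the union of two injections of neurons. -/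
def indMat₂ {a b : ℕ} (σ τ : Fin b → Fin a) : Matrix (Fin a) (Fin b) ℝ :=
  Matrix.of fun r j => if r = σ j ∨ r = τ j then 1 else 0

theorem indMat_transpose_mul {a b : ℕ} (σ : Fin b → Fin a) (A : Matrix (Fin a) (Fin b) ℝ)
    (i j : Fin b) : ((indMat σ).transpose * A) i j = A (σ i) j := by
  simp [Matrix.mul_apply, indMat]

theorem indMat₂_comm {a b : ℕ} (σ τ : Fin b → Fin a) : indMat₂ σ τ = indMat₂ τ σ := by
  ext r j
  simp [indMat₂, or_comm]

/-- Two injections of neurons that collide only where they agree. -/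
def Compat {a b : ℕ} (σ τ : Fin b → Fin a) : Prop :=
  Function.Injective σ ∧ Function.Injective τ ∧ ∀ i j, σ i = τ j → i = j

theorem Compat.symm {a b : ℕ} {σ τ : Fin b → Fin a} (H : Compat σ τ) : Compat τ σ :=
  ⟨H.2.1, H.1, fun i j hij => (H.2.2 j i hij.symm).symm⟩

theorem Compat.transpose_mul {a b : ℕ} {σ τ : Fin b → Fin a} (H : Compat σ τ) :
    (indMat σ).transpose * indMat₂ σ τ = 1 := by
  ext i j
  rw [indMat_transpose_mul, Matrix.one_apply]
  simp only [indMat₂, Matrix.of_apply]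
  refine if_congr ⟨?_, ?_⟩ rfl rfl
  · rintro (h | h)
    · exact H.1 h
    · exact H.2.2 _ _ h
  · rintro rfl
    exact Or.inl rfl

theorem Compat.transpose_mul_self {a b : ℕ} {σ τ : Fin b → Fin a} (H : Compat σ τ) :
    (indMat σ).transpose * indMat σ = 1 := by
  ext i j
  rw [indMat_transpose_mul, Matrix.one_apply]
  simp [indMat, H.1.eq_iff]

theorem Compat.indMat₂_uniq {a b : ℕ} {σ τ : Fin b → Fin a} (H : Compat σ τ) (r : Fin a)
    (j j' : Fin b) (hj : indMat₂ σ τ r j ≠ 0) (hj' : indMat₂ σ τ r j' ≠ 0) : j = j' := by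
  simp only [indMat₂, Matrix.of_apply, ne_eq, ite_eq_right_iff, one_ne_zero, imp_false,
    not_not] at hj hj'
  rcases hj with h | h <;> rcases hj' with h' | h'
  · exact H.1 (h.symm.trans h')
  · exact H.2.2 _ _ (h.symm.trans h')
  · exact (H.2.2 _ _ (h'.symm.trans h)).symm
  · exact H.2.1 (h.symm.trans h')

/-- The second copy grows with strength `u`, but only the first one is read. Compatibility prevents
a neuron from receiving two different sources. -/
theorem Compat.mulE_write {a b : ℕ} {σ τ : Fin b → Fin a} (H : Compat σ τ) {u : ℝ}
    (hu : u ∈ Icc (0 : ℝ) 1) (v : E b) :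
    mulE (indMat σ).transpose (relu (mulE ((1 - u) • indMat σ + u • indMat₂ σ τ) v)) =
      relu v := by
  have h1 : 0 ≤ 1 - u := by linarith [hu.2]
  refine mulE_relu_mulE ?_ ?_ ?_ v
  · intro r j
    simp only [Matrix.add_apply, Matrix.smul_apply, indMat, indMat₂, Matrix.of_apply, smul_eq_mul]
    have := hu.1
    split_ifs <;> simp <;> linarith
  · intro r j j' hj hj'
    refine H.indMat₂_uniq r j j' ?_ ?_ <;>
    · intro h0
      simp only [indMat₂, Matrix.of_apply, ite_eq_right_iff, one_ne_zero, imp_false,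
        not_or] at h0
      simp_all [indMat, indMat₂]
  · rw [Matrix.mul_add, Matrix.mul_smul, Matrix.mul_smul, H.transpose_mul, H.transpose_mul_self,
      ← add_smul]
    simp

/-- Both places hold the same value, so every affine combination of the two readings returns it. -/
theorem Compat.mulE_read {a b : ℕ} {σ τ : Fin b → Fin a} (H : Compat σ τ) (u : ℝ) (v : E b) :
    mulE ((1 - u) • indMat σ + u • indMat τ).transpose (relu (mulE (indMat₂ σ τ) v)) =
      relu v := by
  refine mulE_relu_mulE ?_ H.indMat₂_uniq ?_ v
  · intro r j
    simp only [indMat₂, Matrix.of_apply]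
    split_ifs <;> simp
  · rw [Matrix.transpose_add, Matrix.transpose_smul, Matrix.transpose_smul, Matrix.add_mul,
      Matrix.smul_mul, Matrix.smul_mul, H.transpose_mul, indMat₂_comm, H.symm.transpose_mul,
      ← add_smul]
    simp

/-- Injections with values in prescribed sets that collide only where they agree. -/
theorem exists_compat {a b : ℕ} (S T : Finset (Fin a)) (hS : b ≤ S.card) (hT : b ≤ T.card) :
    ∃ σ τ : Fin b → Fin a, Compat σ τ ∧ (∀ j, σ j ∈ S) ∧ ∀ j, τ j ∈ T := by
  obtain ⟨S', hS', hSc⟩ := Finset.exists_subset_card_eq hS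
  obtain ⟨T', hT', hTc⟩ := Finset.exists_subset_card_eq hT
  have hcard : (S' \ T').card = (T' \ S').card := by
    rw [Finset.card_sdiff_comm (hSc.trans hTc.symm)]
  let e := Finset.equivOfCardEq hcard
  let s := (Finset.equivFinOfCardEq hSc).symm
  have hs : ∀ j, (s j : Fin a) ∈ S' := fun j => (s j).2
  classical
  -- Places common to `S'` and `T'` keep their index, so that the two copies agree where they
  -- overlap; the others are matched with `T' \ S'`.
  let τ : Fin b → Fin a := fun j =>
    if hj : (s j : Fin a) ∈ T' then s j else e ⟨s j, Finset.mem_sdiff.2 ⟨hs j, hj⟩⟩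
  have hτ : ∀ j (hj : (s j : Fin a) ∉ T'), τ j ∈ T' \ S' := fun j hj => by
    simp only [τ, hj, dif_neg, not_false_iff]
    exact (e _).2
  have hσinj : Function.Injective fun j => (s j : Fin a) :=
    Subtype.val_injective.comp s.injective
  have hcol : ∀ i j, (s i : Fin a) = τ j → i = j := by
    intro i j hij
    by_cases hj : (s j : Fin a) ∈ T'
    · simp only [τ, hj, dif_pos] at hij
      exact hσinj hij
    · have := hτ j hj
      rw [← hij] at this
      exact absurd (hs i) (Finset.mem_sdiff.1 this).2
  refine ⟨fun j => s j, τ, ⟨hσinj, ?_, hcol⟩, fun j => hS' (hs j), fun j => hT' ?_⟩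
  · intro i j hij
    by_cases hi : (s i : Fin a) ∈ T'
    · refine hcol i j ?_
      rw [← hij]
      simp [τ, hi]
    · by_cases hj : (s j : Fin a) ∈ T'
      · refine (hcol j i ?_).symm
        rw [hij]
        simp [τ, hj]
      · simp only [τ, hi, hj, dif_neg, not_false_iff] at hij
        have := e.injective (Subtype.val_injective hij)
        exact hσinj (Subtype.mk.inj this)
  · by_cases hj : (s j : Fin a) ∈ T'
    · simp [τ, hj]
    · exact (Finset.mem_sdiff.1 (hτ j hj)).1

end Embedding

/-! ### Polygonal paths -/

section Polygon

theorem exists_polygon {V : Type*} [TopologicalSpace V] [AddCommGroup V] [Module ℝ V]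
    [ContinuousAdd V] [ContinuousSMul ℝ V] {n : ℕ} (hn : 1 ≤ n) (v : ℕ → V) :
    ∃ γ : Path (v 0) (v n), HasSegments n γ ∧
      ∀ t, ∃ k < n, ∃ u ∈ Icc (0 : ℝ) 1, γ t = (1 - u) • v k + u • v (k + 1) := by
  have hn0 : (0 : ℝ) < n := by exact_mod_cast hn
  -- The `k`-th clamped coefficient rises from 0 to 1 on `[k / n, (k + 1) / n]` and is constant
  -- elsewhere, so continuity needs no gluing.
  let G : ℝ → V := fun t =>
    v 0 + ∑ k ∈ Finset.range n, max 0 (min ((n : ℝ) * t - k) 1) • (v (k + 1) - v k)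
  have hG : Continuous G := by
    refine continuous_const.add (continuous_finsetSum _ fun k _ => ?_)
    exact Continuous.smul (by fun_prop) continuous_const
  have key : ∀ k < n, ∀ u ∈ Icc (0 : ℝ) 1,
      G ((k + u) / n) = (1 - u) • v k + u • v (k + 1) := by
    intro k hk u hu
    have h1 : (n : ℝ) * ((k + u) / n) = k + u := by field_simp
    simp only [G, h1]
    rw [← Finset.sum_subset (Finset.range_subset_range.2 (Nat.succ_le_of_lt hk)),
      Finset.sum_range_succ, Finset.sum_congr rfl
        (g := fun j => v (j + 1) - v j), Finset.sum_range_sub]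
    · have : max 0 (min ((k : ℝ) + u - k) 1) = u := by
        rw [add_sub_cancel_left, min_eq_left hu.2, max_eq_right hu.1]
      rw [this]
      module
    · intro j hj
      have : (j : ℝ) + 1 ≤ k := by exact_mod_cast Finset.mem_range.1 hj
      rw [min_eq_right (by linarith [hu.1]), max_eq_right zero_le_one, one_smul]
    · intro j _ hj
      have : (k : ℝ) + 1 ≤ j := by
        have := fun hh => hj (Finset.mem_range.2 hh)
        exact_mod_cast not_lt.1 this
      rw [max_eq_left ((min_le_left _ _).trans (by linarith [hu.2])), zero_smul]
  have hk0 : ∀ k : ℕ, k ≤ n → G ((k : ℝ) / n) = v k := by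
    intro k hk
    rcases Nat.lt_or_ge k n with h | h
    · simpa using key k h 0 (by simp)
    · obtain ⟨e, rfl⟩ : ∃ e, n = e + 1 := ⟨n - 1, by omega⟩
      have hke : k = e + 1 := le_antisymm hk h
      subst hke
      simpa using key e (Nat.lt_succ_self e) 1 (by simp)
  let γ : Path (v 0) (v n) :=
    { toFun := fun t => G t
      continuous_toFun := hG.comp continuous_subtype_val
      source' := by simpa using hk0 0 (by omega)
      target' := by simpa [hn0.ne'] using hk0 n le_rfl }
  have hγ : ∀ t ∈ Icc (0 : ℝ) 1, γ.extend t = G t := fun t ht => by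
    rw [Path.extend_apply _ ht]
    rfl
  refine ⟨γ, ⟨fun k => (k : ℕ) / n, ?_, by simp, by simp [hn0.ne'], ?_⟩, ?_⟩
  · intro a b hab
    exact div_lt_div_of_pos_right (by exact_mod_cast hab) hn0
  · intro k u hu
    have hkn : ((k : ℕ) : ℝ) + 1 ≤ n := by exact_mod_cast k.2
    have hkp : (0 : ℝ) ≤ (k : ℕ) := Nat.cast_nonneg _
    have e1 : (1 - u) * ((k.castSucc : ℕ) / n : ℝ) + u * ((k.succ : ℕ) / n) = ((k : ℕ) + u) / n := by
      simp
      ring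
    have e2 : γ.extend (((k.castSucc : ℕ) : ℝ) / n) = v k := by
      rw [hγ]
      · exact hk0 k k.2.le
      · simp only [Fin.val_castSucc]
        exact ⟨by positivity, (div_le_one hn0).2 (by linarith)⟩
    have e3 : γ.extend (((k.succ : ℕ) : ℝ) / n) = v (k + 1) := by
      rw [hγ]
      · exact hk0 (k + 1) k.2
      · simp only [Fin.val_succ, Nat.cast_add, Nat.cast_one]
        exact ⟨by positivity, (div_le_one hn0).2 (by linarith)⟩
    rw [e1, e2, e3, hγ, key k k.2 u hu]
    exact ⟨div_nonneg (by linarith [hu.1]) hn0.le, (div_le_one hn0).2 (by linarith [hu.2])⟩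
  · intro t
    have ht0 : (0 : ℝ) ≤ n * (t : ℝ) := mul_nonneg hn0.le t.2.1
    by_cases h : ⌊(n : ℝ) * t⌋₊ < n
    · refine ⟨_, h, n * t - ⌊(n : ℝ) * t⌋₊, ⟨by linarith [Nat.floor_le ht0],
        by linarith [Nat.lt_floor_add_one ((n : ℝ) * t)]⟩, ?_⟩
      rw [← key _ h]
      · show G t = _
        congr 1
        field_simp
        ring
      · exact ⟨by linarith [Nat.floor_le ht0], by linarith [Nat.lt_floor_add_one ((n : ℝ) * t)]⟩
    · have h2 : (n : ℝ) ≤ n * t := by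
        refine le_trans ?_ (Nat.floor_le ht0)
        exact_mod_cast not_lt.1 h
      have h3 : (t : ℝ) = 1 := le_antisymm t.2.2 (by nlinarith)
      refine ⟨n - 1, by omega, 1, by simp, ?_⟩
      show G t = _
      rw [h3]
      have : n - 1 + 1 = n := by omega
      simpa [this, hn0.ne'] using hk0 n le_rfl

end Polygon

/-! ### Loss along segments -/

section Segments

variable {d m : ℕ} {h hstar : ℕ → ℕ}

/-- The loss is at most `B` along the segment from `θ` to `θ'`. -/
def LossOn (l : E (h d) → E (h d) → ℝ) (X : Fin m → E (h 0)) (Y : Fin m → E (h d)) (B : ℝ)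
    (θ θ' : Params d h) : Prop :=
  ∀ u ∈ Icc (0 : ℝ) 1, empLoss l X Y (net ((1 - u) • θ + u • θ')) ≤ B

variable {l : E (h d) → E (h d) → ℝ} {X : Fin m → E (h 0)} {Y : Fin m → E (h d)} {B : ℝ}
  {θ θ' : Params d h}

theorem LossOn.symm (H : LossOn l X Y B θ θ') : LossOn l X Y B θ' θ := by
  intro u hu
  have := H (1 - u) ⟨by linarith [hu.2], by linarith [hu.1]⟩
  rwa [sub_sub_cancel, add_comm] at this

theorem LossOn.mono {B' : ℝ} (H : LossOn l X Y B θ θ') (hB : B ≤ B') : LossOn l X Y B' θ θ' :=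
  fun u hu => (H u hu).trans hB

theorem LossOn.left (H : LossOn l X Y B θ θ') : empLoss l X Y (net θ) ≤ B := by
  simpa using H 0 (by simp)

theorem LossOn.right (H : LossOn l X Y B θ θ') : empLoss l X Y (net θ') ≤ B := by
  simpa using H 1 (by simp)

theorem lossOn_self (H : empLoss l X Y (net θ) ≤ B) : LossOn l X Y B θ θ := by
  intro u _
  rwa [← add_smul, sub_add_cancel, one_smul]

theorem lossOn_of_eq {f : E (h 0) → E (h d)} (hf : empLoss l X Y f ≤ B)
    (H : ∀ u ∈ Icc (0 : ℝ) 1, ∀ x, net ((1 - u) • θ + u • θ') x = f x) :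
    LossOn l X Y B θ θ' := by
  intro u hu
  rwa [show net ((1 - u) • θ + u • θ') = f from funext (H u hu)]

theorem empLoss_convex (hl : ∀ y, ConvexOn ℝ univ (l y)) {f g : E (h 0) → E (h d)}
    (hf : empLoss l X Y f ≤ B) (hg : empLoss l X Y g ≤ B) {u : ℝ} (hu : u ∈ Icc (0 : ℝ) 1) :
    empLoss l X Y (fun x => (1 - u) • f x + u • g x) ≤ B := by
  have h1 : 0 ≤ 1 - u := by linarith [hu.2]
  have : empLoss l X Y (fun x => (1 - u) • f x + u • g x) ≤
      (1 - u) * empLoss l X Y f + u * empLoss l X Y g := by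
    have e : (1 - u) * empLoss l X Y f + u * empLoss l X Y g =
        (1 / (m : ℝ)) * ∑ s, ((1 - u) * l (Y s) (f (X s)) + u * l (Y s) (g (X s))) := by
      simp only [empLoss, Finset.sum_add_distrib, ← Finset.mul_sum]
      ring
    rw [e]
    refine mul_le_mul_of_nonneg_left (Finset.sum_le_sum fun s _ => ?_) (by positivity)
    simpa using (hl (Y s)).2 (mem_univ (f (X s))) (mem_univ (g (X s))) h1 hu.1 (by ring)
  nlinarith [hu.1]

/-- With the earlier layers fixed, the output is affine along the segment. This is where convexity
of the loss enters. -/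
theorem lossOn_last (hl : ∀ y, ConvexOn ℝ univ (l y)) (hd : 1 ≤ d)
    (H : ∀ k : Fin d, (k : ℕ) + 1 < d → θ k = θ' k) (hθ : empLoss l X Y (net θ) ≤ B)
    (hθ' : empLoss l X Y (net θ') ≤ B) : LossOn l X Y B θ θ' := by
  intro u hu
  rw [show net ((1 - u) • θ + u • θ') = _ from funext fun x => net_affine_last x H hd u]
  exact empLoss_convex hl hθ hθ' hu

/-- From a network with dead neurons to the embedding of another network in these neurons. -/
theorem exists_to_emb (hl : ∀ y, ConvexOn ℝ univ (l y)) (hd : 2 ≤ d) {θstar : Params d hstar}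
    (P : ∀ k, Matrix (Fin (h k)) (Fin (hstar k)) ℝ) (D : ∀ k, Set (Fin (h k)))
    (hDd : D d = ∅)
    (hP : ∀ k, 1 ≤ k → k < d → ∀ r ∉ D k, ∀ a, P k r a = 0)
    (hzero : ∀ k : Fin d, ∀ r, ∀ j ∈ D k, θ k r j = 0)
    (hθ : empLoss l X Y (net θ) ≤ B) (hemb : empLoss l X Y (net (emb P P θstar)) ≤ B) :
    ∃ θ₂ θ₃ : Params d h, LossOn l X Y B θ θ₂ ∧ LossOn l X Y B θ₂ θ₃ ∧
      LossOn l X Y B θ₃ (emb P P θstar) := by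
  classical
  -- The rows of the copy are written into neurons that nobody reads; then the last matrix is
  -- exchanged. From there on only the copy is read, and all other rows can move freely to their
  -- final values.
  let θ₂ : Params d h := fun k => Matrix.of fun r j =>
    if (k : ℕ) + 1 < d ∧ r ∈ D (k + 1) then emb P P θstar k r j else θ k r j
  let θ₃ : Params d h := fun k => if (k : ℕ) + 1 < d then θ₂ k else emb P P θstar k
  have hE : ∀ k : Fin d, (k : ℕ) ≠ 0 → ∀ r, ∀ j ∉ D k, emb P P θstar k r j = 0 := by
    intro k hk r j hj
    simp only [emb, Matrix.mul_apply (N := (P k).transpose), Matrix.transpose_apply]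
    exact Finset.sum_eq_zero fun b _ => by
      rw [hP k (by omega) k.2 j hj b, mul_zero]
  have h12 : ∀ u ∈ Icc (0 : ℝ) 1, ∀ x, net ((1 - u) • θ + u • θ₂) x = net θ x := by
    intro u _ x
    have hr : ∀ k : Fin d, ∀ r ∉ D (k + 1), ∀ j, ((1 - u) • θ + u • θ₂) k r j = θ k r j := by
      intro k r hr j
      simp only [Pi.add_apply, Pi.smul_apply, Matrix.add_apply, Matrix.smul_apply, smul_eq_mul,
        θ₂, Matrix.of_apply, hr, and_false, if_false]
      ring
    refine net_eq_of_off x D hDd hr fun k r hr' j hj => ?_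
    rw [hr k r hr' j, hzero k r j hj]
  -- The roles are now reversed: the hidden neurons outside `D` are the unread ones, since the copy
  -- reads only inside `D`.
  let D' : ∀ k, Set (Fin (h k)) := fun k => if 1 ≤ k ∧ k < d then (D k)ᶜ else ∅
  have h34 : ∀ u ∈ Icc (0 : ℝ) 1, ∀ x,
      net ((1 - u) • θ₃ + u • emb P P θstar) x = net (emb P P θstar) x := by
    intro u _ x
    have hr : ∀ k : Fin d, ∀ r ∉ D' (k + 1), ∀ j,
        ((1 - u) • θ₃ + u • emb P P θstar) k r j = emb P P θstar k r j := by
      intro k r hr j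
      have : θ₃ k r j = emb P P θstar k r j := by
        by_cases hk : (k : ℕ) + 1 < d
        · have : r ∈ D (k + 1) := by simpa [D', hk] using hr
          simp [θ₃, θ₂, hk, this]
        · simp [θ₃, hk]
      simp only [Pi.add_apply, Pi.smul_apply, Matrix.add_apply, Matrix.smul_apply, this,
        ← add_smul]
      simp
    refine net_eq_of_off x D' (by simp [D']) hr fun k r hr' j hj => ?_
    have hk : 1 ≤ (k : ℕ) := by
      by_contra hk
      simp [D', hk] at hj
    have hj' : j ∉ D k := by simpa [D', hk] using hj
    rw [hr k r hr' j, hE k (by omega) r j hj']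
  have n2 : net θ₂ = net θ := funext fun x => by simpa using h12 1 (by simp) x
  have n3 : net θ₃ = net (emb P P θstar) := funext fun x => by simpa using h34 0 (by simp) x
  refine ⟨θ₂, θ₃, lossOn_of_eq hθ h12, lossOn_last hl (by omega) (fun k hk => ?_) (n2 ▸ hθ)
    (n3 ▸ hemb), lossOn_of_eq hemb h34⟩
  simp [θ₃, hk]

end Segments

/-! ### Connecting two networks with dead neurons -/

section Connect

variable {d m : ℕ} {h hstar : ℕ → ℕ}

theorem emb_affine_left (α α' β : ∀ k, Matrix (Fin (h k)) (Fin (hstar k)) ℝ)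
    (θ : Params d hstar) (u : ℝ) :
    (1 - u) • emb α β θ + u • emb α' β θ =
      emb (fun k => (1 - u) • α k + u • α' k) β θ := by
  funext k
  simp [emb, Matrix.add_mul]

theorem emb_affine_right (α β β' : ∀ k, Matrix (Fin (h k)) (Fin (hstar k)) ℝ)
    (θ : Params d hstar) (u : ℝ) :
    (1 - u) • emb α β θ + u • emb α β' θ =
      emb α (fun k => (1 - u) • β k + u • β' k) θ := by
  funext k
  simp [emb, Matrix.mul_add]

theorem affine_self {V : Type*} [AddCommGroup V] [Module ℝ V] (v : V) (u : ℝ) :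
    (1 - u) • v + u • v = v := by
  rw [← add_smul, sub_add_cancel, one_smul]

/-- Networks that can be connected to networks with enough dead neurons can be connected with each
other. -/
theorem exists_path_of_dead {l : E (h d) → E (h d) → ℝ} {X : Fin m → E (h 0)}
    {Y : Fin m → E (h d)} {B : ℝ} {θA θB θA' θB' : Params d h} {θstar : Params d hstar}
    (hin : hstar 0 = h 0) (hout : hstar d = h d) (hl : ∀ y, ConvexOn ℝ univ (l y)) (hd : 2 ≤ d)
    (DA DB : ∀ k, Finset (Fin (h k)))
    (hA : ∀ k, 1 ≤ k → k < d → hstar k ≤ (DA k).card)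
    (hB : ∀ k, 1 ≤ k → k < d → hstar k ≤ (DB k).card)
    (hA0 : ∀ k : Fin d, 1 ≤ (k : ℕ) → ∀ r, ∀ j ∈ DA k, θA' k r j = 0)
    (hB0 : ∀ k : Fin d, 1 ≤ (k : ℕ) → ∀ r, ∀ j ∈ DB k, θB' k r j = 0)
    (hLA : LossOn l X Y B θA θA') (hLB : LossOn l X Y B θB θB')
    (hLstar : empLoss l X Y (fun x => castE hout (net θstar (castE hin.symm x))) ≤ B) :
    ∃ γ : Path θA θB, HasSegments 13 γ ∧ ∀ t, empLoss l X Y (net (γ t)) ≤ B := by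
  -- `P` and `Q` place the copies in the dead neurons of the two ends, and `R` places it in both. At
  -- the input and output layers all three are the same identification, hence constant under
  -- interpolation.
  have hex : ∀ k, ∃ P Q R : Matrix (Fin (h k)) (Fin (hstar k)) ℝ,
      (¬ (1 ≤ k ∧ k < d) → P = castMat _ _ ∧ Q = castMat _ _ ∧ R = castMat _ _) ∧
      (1 ≤ k → k < d → ∃ σ τ : Fin (hstar k) → Fin (h k), Compat σ τ ∧ (∀ j, σ j ∈ DA k) ∧
        (∀ j, τ j ∈ DB k) ∧ P = indMat σ ∧ Q = indMat τ ∧ R = indMat₂ σ τ) := by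
    intro k
    by_cases hk : 1 ≤ k ∧ k < d
    · obtain ⟨σ, τ, H, hσ, hτ⟩ := exists_compat (DA k) (DB k) (hA k hk.1 hk.2) (hB k hk.1 hk.2)
      exact ⟨_, _, _, fun h => absurd hk h, fun _ _ => ⟨σ, τ, H, hσ, hτ, rfl, rfl, rfl⟩⟩
    · exact ⟨_, _, _, fun _ => ⟨rfl, rfl, rfl⟩, fun h1 h2 => absurd ⟨h1, h2⟩ hk⟩
  choose P Q R hcast hmid using hex
  have hc0 := hcast 0 (by omega)
  have hcd := hcast d (by omega)
  have hnet : ∀ α β : ∀ k, Matrix (Fin (h k)) (Fin (hstar k)) ℝ, β 0 = castMat _ _ →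
      α d = castMat _ _ →
      (∀ k, 1 ≤ k → k < d → ∀ v, mulE (β k).transpose (relu (mulE (α k) v)) = relu v) →
      ∀ x, net (emb α β θstar) x = castE hout (net θstar (castE hin.symm x)) := by
    intro α β h0 h1 h2 x
    refine net_emb hin hout (by omega) (fun x => ?_) h2 (fun v => ?_) x
    · rw [h0, castMat_transpose, mulE_castMat]
    · rw [h1, mulE_castMat]
  have hPR : LossOn l X Y B (emb P P θstar) (emb R P θstar) := by
    refine lossOn_of_eq hLstar fun u hu => ?_
    rw [emb_affine_left]
    refine hnet _ _ hc0.1 (by rw [hcd.1, hcd.2.2, affine_self]) fun k h1 h2 v => ?_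
    obtain ⟨σ, τ, H, -, -, e1, -, e3⟩ := hmid k h1 h2
    rw [e1, e3]
    exact H.mulE_write hu v
  have hRR : LossOn l X Y B (emb R P θstar) (emb R Q θstar) := by
    refine lossOn_of_eq hLstar fun u hu => ?_
    rw [emb_affine_right]
    refine hnet _ _ (by rw [hc0.1, hc0.2.1, affine_self]) hcd.2.2 fun k h1 h2 v => ?_
    obtain ⟨σ, τ, H, -, -, e1, e2, e3⟩ := hmid k h1 h2
    rw [e1, e2, e3]
    exact H.mulE_read u v
  have hQR : LossOn l X Y B (emb Q Q θstar) (emb R Q θstar) := by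
    refine lossOn_of_eq hLstar fun u hu => ?_
    rw [emb_affine_left]
    refine hnet _ _ hc0.2.1 (by rw [hcd.2.1, hcd.2.2, affine_self]) fun k h1 h2 v => ?_
    obtain ⟨σ, τ, H, -, -, -, e2, e3⟩ := hmid k h1 h2
    rw [e2, e3, indMat₂_comm]
    exact H.symm.mulE_write hu v
  have hside : ∀ (P : ∀ k, Matrix (Fin (h k)) (Fin (hstar k)) ℝ) (D : ∀ k, Finset (Fin (h k)))
      (θ : Params d h), (∀ k, 1 ≤ k → k < d → ∃ σ : Fin (hstar k) → Fin (h k),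
        (∀ j, σ j ∈ D k) ∧ P k = indMat σ) →
      (∀ k : Fin d, 1 ≤ (k : ℕ) → ∀ r, ∀ j ∈ D k, θ k r j = 0) →
      empLoss l X Y (net θ) ≤ B → empLoss l X Y (net (emb P P θstar)) ≤ B →
      ∃ θ₂ θ₃ : Params d h, LossOn l X Y B θ θ₂ ∧ LossOn l X Y B θ₂ θ₃ ∧
        LossOn l X Y B θ₃ (emb P P θstar) := by
    intro P D θ hP hD hθ hE
    refine exists_to_emb hl hd P (fun k => if 1 ≤ k ∧ k < d then (D k : Set (Fin (h k))) else ∅)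
      (by simp) (fun k h1 h2 r hr a => ?_) (fun k r j hj => ?_) hθ hE
    · obtain ⟨σ, hσ, e⟩ := hP k h1 h2
      have hr' : r ∉ D k := by simpa [h1, h2] using hr
      have : r ≠ σ a := fun h => hr' (h ▸ hσ a)
      simp [e, indMat, this]
    · by_cases hk : 1 ≤ (k : ℕ)
      · exact hD k hk r j (by simpa [hk] using hj)
      · simp [hk] at hj
  obtain ⟨A₂, A₃, a1, a2, a3⟩ := hside P DA θA' (fun k h1 h2 => by
    obtain ⟨σ, τ, -, hσ, -, e, -⟩ := hmid k h1 h2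
    exact ⟨σ, hσ, e⟩) hA0 hLA.right hPR.left
  obtain ⟨B₂, B₃, b1, b2, b3⟩ := hside Q DB θB' (fun k h1 h2 => by
    obtain ⟨σ, τ, -, -, hτ, -, e, -⟩ := hmid k h1 h2
    exact ⟨τ, hτ, e⟩) hB0 hLB.right hQR.left
  -- Eleven segments do the work. The default value makes the vertices 11, 12 and 13 equal, so the
  -- last two segments are constant.
  let v : ℕ → Params d h
    | 0 => θA
    | 1 => θA'
    | 2 => A₂
    | 3 => A₃
    | 4 => emb P P θstar
    | 5 => emb R P θstar
    | 6 => emb R Q θstar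
    | 7 => emb Q Q θstar
    | 8 => B₃
    | 9 => B₂
    | 10 => θB'
    | _ => θB
  have hB' := lossOn_self hLB.left
  have hv : ∀ k < 13, LossOn l X Y B (v k) (v (k + 1)) := by
    intro k hk
    interval_cases k
    exacts [hLA, a1, a2, a3, hPR, hRR, hQR.symm, b3.symm, b2.symm, b1.symm, hLB.symm, hB', hB']
  obtain ⟨γ, hγ, hγv⟩ := exists_polygon (n := 13) (by norm_num) v
  refine ⟨γ, hγ, fun t => ?_⟩
  obtain ⟨k, hk, u, hu, e⟩ := hγv t
  rw [e]
  exact hv k hk u hu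

end Connect

/-! ### Independent bits and a Chernoff bound -/

section Bits

variable {ι : Type*} [Fintype ι] {p : ℝ}

/-- The probability of one bit. -/
def bitProb (p : ℝ) (b : Bool) : ℝ := if b then p else 1 - p

/-- The probability of a family of independent bits. -/
def weight (p : ℝ) (ω : ι → Bool) : ℝ := ∏ c, bitProb p (ω c)

theorem bitProb_nonneg (h0 : 0 ≤ p) (h1 : p ≤ 1) (b : Bool) : 0 ≤ bitProb p b := by
  unfold bitProb
  split_ifs <;> linarith

theorem weight_nonneg (h0 : 0 ≤ p) (h1 : p ≤ 1) (ω : ι → Bool) : 0 ≤ weight p ω :=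
  Finset.prod_nonneg fun _ _ => bitProb_nonneg h0 h1 _

variable [DecidableEq ι]

/-- The expectation over independent bits. -/
def expect (p : ℝ) (F : (ι → Bool) → ℝ) : ℝ := ∑ ω, weight p ω * F ω

/-- The probability of an event that depends on independent bits. -/
def prob (p : ℝ) (S : Set (ι → Bool)) : ℝ := expect p (S.indicator fun _ => 1)

theorem expect_mono (h0 : 0 ≤ p) (h1 : p ≤ 1) {F G : (ι → Bool) → ℝ} (H : ∀ ω, F ω ≤ G ω) :
    expect p F ≤ expect p G :=
  Finset.sum_le_sum fun ω _ => mul_le_mul_of_nonneg_left (H ω) (weight_nonneg h0 h1 ω)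

theorem expect_const_mul (a : ℝ) (F : (ι → Bool) → ℝ) :
    expect p (fun ω => a * F ω) = a * expect p F := by
  simp only [expect, Finset.mul_sum]
  exact Finset.sum_congr rfl fun _ _ => by ring

theorem expect_one : expect p (fun _ : ι → Bool => 1) = 1 := by
  have := Finset.prod_univ_sum (fun _ : ι => (Finset.univ : Finset Bool))
    (fun _ b => bitProb p b)
  simp only [Fintype.piFinset_univ] at this
  simp only [expect, weight, mul_one, ← this]
  exact Finset.prod_eq_one fun _ _ => by simp [bitProb]

/-- Averaging over one bit does not change the expectation. -/
theorem expect_resample (c : ι) (F : (ι → Bool) → ℝ) :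
    expect p F = expect p fun ω =>
      p * F (Function.update ω c true) + (1 - p) * F (Function.update ω c false) := by
  let e := Equiv.funSplitAt c Bool
  have hw : ∀ z, weight p (e.symm z) = bitProb p z.1 * ∏ j, bitProb p (z.2 j) := by
    intro z
    rw [weight, ← Finset.mul_prod_erase _ _ (Finset.mem_univ c)]
    congr 1
    · simp [e]
    · rw [Finset.prod_subtype (p := fun j => j ≠ c) (Finset.univ.erase c) (by simp)
        (fun j => bitProb p (e.symm z j))]
      · refine Finset.prod_congr rfl fun j _ => ?_
        have := j.2
        simp [e, this]
  have hu : ∀ z b, Function.update (e.symm z) c b = e.symm (b, z.2) := by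
    intro z b
    ext j
    by_cases hj : j = c
    · subst hj; simp [e]
    · simp [e, hj]
  have hs : ∀ G : (ι → Bool) → ℝ, expect p G = ∑ g : {j // j ≠ c} → Bool,
      (∏ j, bitProb p (g j)) * (p * G (e.symm (true, g)) + (1 - p) * G (e.symm (false, g))) := by
    intro G
    rw [expect, ← Equiv.sum_comp e.symm, Fintype.sum_prod_type_right]
    refine Finset.sum_congr rfl fun g _ => ?_
    simp only [hw, Fintype.sum_bool, bitProb]
    simp
    ring
  rw [hs, hs]
  refine Finset.sum_congr rfl fun g _ => ?_
  simp only [hu]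
  ring

theorem prob_nonneg (h0 : 0 ≤ p) (h1 : p ≤ 1) (S : Set (ι → Bool)) : 0 ≤ prob p S :=
  Finset.sum_nonneg fun ω _ => mul_nonneg (weight_nonneg h0 h1 ω)
    (Set.indicator_nonneg (fun _ _ => zero_le_one) ω)

theorem prob_le_sum (h0 : 0 ≤ p) (h1 : p ≤ 1) {κ : Type*} (s : Finset κ) {S : Set (ι → Bool)}
    (T : κ → Set (ι → Bool)) (H : ∀ ω ∈ S, ∃ i ∈ s, ω ∈ T i) :
    prob p S ≤ ∑ i ∈ s, prob p (T i) := by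
  have : ∑ i ∈ s, prob p (T i) =
      expect p fun ω => ∑ i ∈ s, (T i).indicator (fun _ => (1 : ℝ)) ω := by
    simp only [prob, expect, Finset.mul_sum]
    exact Finset.sum_comm
  rw [this]
  refine expect_mono h0 h1 fun ω => ?_
  have hn : ∀ i ∈ s, 0 ≤ (T i).indicator (fun _ => (1 : ℝ)) ω := fun i _ =>
    Set.indicator_nonneg (fun _ _ => zero_le_one) ω
  by_cases hω : ω ∈ S
  · obtain ⟨i, hi, hT⟩ := H ω hω
    rw [Set.indicator_of_mem hω]
    refine le_trans ?_ (Finset.single_le_sum hn hi)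
    simp [hT]
  · rw [Set.indicator_of_notMem hω]
    exact Finset.sum_nonneg hn

/-- Markov's inequality. -/
theorem prob_le_of_expect (h0 : 0 ≤ p) (h1 : p ≤ 1) {S : Set (ι → Bool)}
    {F : (ι → Bool) → ℝ} (hF : ∀ ω, 0 ≤ F ω) {a : ℝ} (ha : 0 < a) (H : ∀ ω ∈ S, a ≤ F ω) :
    prob p S ≤ a⁻¹ * expect p F := by
  rw [← expect_const_mul]
  refine expect_mono h0 h1 fun ω => ?_
  by_cases hω : ω ∈ S
  · rw [Set.indicator_of_mem hω, inv_mul_eq_div, le_div_iff₀ ha, one_mul]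
    exact H ω hω
  · rw [Set.indicator_of_notMem hω]
    exact mul_nonneg (inv_nonneg.2 ha.le) (hF ω)

theorem pi_bitLaw_apply (h0 : 0 ≤ p) (h1 : p ≤ 1) (S : Set (ι → Bool)) :
    Measure.pi (fun _ : ι => bitLaw p) S = ENNReal.ofReal (prob p S) := by
  classical
  have hb : ∀ b, bitLaw p {b} = ENNReal.ofReal (bitProb p b) := by
    intro b
    cases b <;> simp [bitLaw, bitProb]
  have hs : ∀ ω : ι → Bool, Measure.pi (fun _ : ι => bitLaw p) {ω} =
      ENNReal.ofReal (weight p ω) := by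
    intro ω
    rw [Measure.pi_singleton, weight, ENNReal.ofReal_prod_of_nonneg fun _ _ =>
      bitProb_nonneg h0 h1 _]
    exact Finset.prod_congr rfl fun _ _ => hb _
  have hS : S = ((Finset.univ.filter (· ∈ S) : Finset (ι → Bool)) : Set (ι → Bool)) := by
    ext; simp
  rw [hS, ← sum_measure_singleton]
  simp only [hs]
  rw [← ENNReal.ofReal_sum_of_nonneg fun ω _ => weight_nonneg h0 h1 ω, ← hS, prob, expect,
    Finset.sum_filter]
  congr 1
  refine Finset.sum_congr rfl fun ω _ => ?_
  by_cases hω : ω ∈ S <;> simp [hω]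

/-- The number of bits equal to `true` is not much smaller than its mean. -/
theorem prob_card_lt_le (h0 : 0 ≤ p) (h1 : p ≤ 1) (T : Finset ι) (n : ℕ)
    (hn : 1.5 * (n : ℝ) ≤ p * T.card) :
    prob p {ω : ι → Bool | (T.filter fun c => ω c = true).card < n} ≤ Real.exp (-(n : ℝ) / 20) := by
  -- Chernoff's method with base 2/3: every bit contributes the factor `p * (2 / 3) + (1 - p)`.
  have hE : expect p (fun ω : ι → Bool => (2 / 3 : ℝ) ^ (T.filter fun c => ω c = true).card) =
      (1 - p / 3) ^ T.card := by
    clear hn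
    induction T using Finset.induction_on with
    | empty => simpa using expect_one
    | insert c T hc ih =>
      rw [expect_resample c, Finset.card_insert_of_notMem hc, pow_succ, ← ih, mul_comm,
        ← expect_const_mul]
      congr 1
      funext ω
      have hT : ∀ b, (T.filter fun c' => Function.update ω c b c' = true) =
          T.filter fun c => ω c = true := fun b => by
        refine Finset.filter_congr fun c' hc' => ?_
        have hne : c' ≠ c := fun h => hc (h ▸ hc')
        rw [Function.update_of_ne hne]
      rw [Finset.filter_insert, Finset.filter_insert, hT, hT]
      simp only [Function.update_self, if_true, Bool.false_eq_true, if_false]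
      rw [Finset.card_insert_of_notMem (by simp [hc]), pow_succ]
      ring
  have h23 : (0 : ℝ) < (2 / 3 : ℝ) ^ n := by positivity
  refine (prob_le_of_expect h0 h1 (F := fun ω => (2 / 3 : ℝ) ^ (T.filter fun c => ω c = true).card)
    (fun ω => by positivity) h23 fun ω hω => ?_).trans ?_
  · exact pow_le_pow_of_le_one (by norm_num) (by norm_num) (le_of_lt hω)
  · rw [hE]
    have e1 : (1 - p / 3) ^ T.card ≤ Real.exp (-(n : ℝ) / 2) := by
      calc (1 - p / 3) ^ T.card ≤ Real.exp (-(p / 3)) ^ T.card := by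
            refine pow_le_pow_left₀ (by linarith) ?_ _
            linarith [Real.add_one_le_exp (-(p / 3))]
        _ = Real.exp (-(p * T.card) / 3) := by
            rw [← Real.exp_nat_mul]
            congr 1
            ring
        _ ≤ _ := Real.exp_le_exp.2 (by linarith)
    -- Since 3/2 is below `exp (9 / 20)`, the loss `9 n / 20` stays below the gain `n / 2`; the
    -- difference is `n / 20`.
    have e2 : ((2 / 3 : ℝ) ^ n)⁻¹ ≤ Real.exp (9 / 20 * n) := by
      rw [← inv_pow, mul_comm, Real.exp_nat_mul]
      refine pow_le_pow_left₀ (by norm_num) ?_ _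
      have := Real.quadratic_le_exp_of_nonneg (x := 9 / 20) (by norm_num)
      norm_num at this ⊢
      linarith
    calc _ ≤ Real.exp (9 / 20 * n) * Real.exp (-(n : ℝ) / 2) :=
          mul_le_mul e2 e1 (pow_nonneg (by linarith) _) (Real.exp_pos _).le
      _ = _ := by
        rw [← Real.exp_add]
        congr 1
        ring

end Bits

/-! ### A dimension-free exponential tail for vector martingales -/

section Martingale

variable {V : Type*} [NormedAddCommGroup V] [InnerProductSpace ℝ V]

/-- The centred dropout factor. -/
def drop (p : ℝ) (b : Bool) : ℝ := (if b then 0 else 1 / (1 - p)) - 1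

/-- A smooth substitute for the norm: its gradient has norm at most 1 and its second derivative is
bounded by 1, in any dimension. -/
theorem sqrt_one_add_norm_sq_le (v x : V) :
    √(1 + ‖v + x‖ ^ 2) ≤ √(1 + ‖v‖ ^ 2) +
      (inner ℝ v x / √(1 + ‖v‖ ^ 2) + ‖x‖ ^ 2 / 2) := by
  set f := √(1 + ‖v‖ ^ 2) with hf
  have hf2 : f ^ 2 = 1 + ‖v‖ ^ 2 := Real.sq_sqrt (by positivity)
  have hf1 : 1 ≤ f := Real.one_le_sqrt.2 (by nlinarith [norm_nonneg v])
  have hin : |inner ℝ v x / f| ≤ ‖x‖ := by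
    rw [abs_div, abs_of_pos (by linarith : 0 < f), div_le_iff₀ (by linarith)]
    have h1 := abs_real_inner_le_norm v x
    have h2 : ‖v‖ ≤ f := Real.le_sqrt_of_sq_le (by linarith)
    nlinarith [norm_nonneg x]
  have hex : inner ℝ v x = f * (inner ℝ v x / f) := by
    field_simp
  set s := inner ℝ v x / f with hs
  have hs' := abs_le.1 hin
  have h0 : 0 ≤ f + (s + ‖x‖ ^ 2 / 2) := by nlinarith [sq_nonneg (‖x‖ - 1)]
  refine Real.sqrt_le_iff.2 ⟨h0, ?_⟩
  rw [norm_add_sq_real, hex]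
  nlinarith [sq_nonneg (s + ‖x‖ ^ 2 / 2), sq_nonneg ‖x‖]

/-- The dropout factor is centred, so the linear terms cancel. Its second moment is `p + p ^ 2 / (1
- p) ≤ 4 p`, and `9 / 4 * 4 = 9`. -/
theorem two_point_exp_le {p : ℝ} (h0 : 0 ≤ p) (h1 : p ≤ 3 / 4) (v u : V) {b : ℝ} (hu : ‖u‖ ≤ b)
    (hb : b ≤ 1 / 6) :
    p * Real.exp √(1 + ‖v + drop p true • u‖ ^ 2) +
      (1 - p) * Real.exp √(1 + ‖v + drop p false • u‖ ^ 2) ≤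
    Real.exp (9 * p * b ^ 2) * Real.exp √(1 + ‖v‖ ^ 2) := by
  set f := √(1 + ‖v‖ ^ 2) with hf
  have hf1 : 1 ≤ f := Real.one_le_sqrt.2 (by nlinarith [norm_nonneg v])
  have hf2 : f ^ 2 = 1 + ‖v‖ ^ 2 := Real.sq_sqrt (by positivity)
  set s := inner ℝ v u / f with hs
  have hsb : |s| ≤ b := by
    refine le_trans ?_ hu
    rw [abs_div, abs_of_pos (by linarith : 0 < f), div_le_iff₀ (by linarith)]
    have h2 : ‖v‖ ≤ f := Real.le_sqrt_of_sq_le (by linarith)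
    nlinarith [norm_nonneg u, abs_real_inner_le_norm v u]
  have hb0 : 0 ≤ b := (norm_nonneg u).trans hu
  obtain ⟨hs1, hs2⟩ := abs_le.1 hsb
  have hu2 : ‖u‖ ^ 2 ≤ b ^ 2 := pow_le_pow_left₀ (norm_nonneg _) hu 2
  have key : ∀ x : ℝ, |x| ≤ 3 → Real.exp √(1 + ‖v + x • u‖ ^ 2) ≤
      Real.exp f * (1 + x * s + 2 * x ^ 2 * b ^ 2 + x ^ 2 * b ^ 2 / 4) := by
    intro x hx
    -- The bound 1/6 on `b` serves here: it keeps the exponent `y` in the range where `exp y ≤ 1 + y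
    -- + y ^ 2`.
    have hxb : |x| * b ≤ 1 / 2 := by nlinarith [abs_nonneg x]
    have e1 : √(1 + ‖v + x • u‖ ^ 2) ≤ f + (x * s + x ^ 2 * b ^ 2 / 2) := by
      refine (sqrt_one_add_norm_sq_le v (x • u)).trans ?_
      rw [inner_smul_right, norm_smul, mul_pow, Real.norm_eq_abs, sq_abs, mul_div_assoc, ← hs]
      nlinarith [sq_nonneg x]
    set y := x * s + x ^ 2 * b ^ 2 / 2 with hy
    have hxs : |x * s| ≤ |x| * b := by
      rw [abs_mul]
      exact mul_le_mul_of_nonneg_left hsb (abs_nonneg x)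
    have hq : x ^ 2 * b ^ 2 = (|x| * b) ^ 2 := by rw [mul_pow, sq_abs]
    have hz0 : 0 ≤ |x| * b := by positivity
    have hy2 : |y| ≤ 5 / 4 * (|x| * b) := by
      refine (abs_add_le _ _).trans ?_
      rw [hq, abs_of_nonneg (by positivity : 0 ≤ (|x| * b) ^ 2 / 2)]
      nlinarith
    have hy1 : |y| ≤ 1 := by linarith
    have e2 := (abs_le.1 (Real.abs_exp_sub_one_sub_id_le hy1)).2
    have hyy : y ^ 2 ≤ (5 / 4) ^ 2 * (|x| * b) ^ 2 := by
      rw [← mul_pow, ← sq_abs y]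
      exact pow_le_pow_left₀ (abs_nonneg _) hy2 2
    calc Real.exp √(1 + ‖v + x • u‖ ^ 2) ≤ Real.exp (f + y) := Real.exp_le_exp.2 e1
      _ = Real.exp f * Real.exp y := Real.exp_add _ _
      _ ≤ _ := by
        refine mul_le_mul_of_nonneg_left ?_ (Real.exp_pos _).le
        rw [mul_assoc 2, hq]
        rw [hq] at hy
        nlinarith [sq_nonneg (|x| * b)]
  have hp1 : 0 < 1 - p := by linarith
  have hdt : drop p true = -1 := by simp [drop]
  have hdf : drop p false = p / (1 - p) := by
    simp only [drop, Bool.false_eq_true, if_false]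
    field_simp
    ring
  have hdf3 : |p / (1 - p)| ≤ 3 := by
    rw [abs_of_nonneg (div_nonneg h0 hp1.le), div_le_iff₀ hp1]
    linarith
  have k1 := key (drop p true) (by rw [hdt]; norm_num)
  have k2 := key (drop p false) (by rw [hdf]; exact hdf3)
  rw [hdt] at k1 ⊢
  rw [hdf] at k2 ⊢
  set r := p / (1 - p) with hr
  have hr' : (1 - p) * r = p := by rw [hr]; field_simp
  have hr0 : 0 ≤ r := div_nonneg h0 hp1.le
  have hr3 : r ≤ 3 := (le_abs_self r).trans hdf3
  have e3 : 1 + 9 * p * b ^ 2 ≤ Real.exp (9 * p * b ^ 2) := by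
    linarith [Real.add_one_le_exp (9 * p * b ^ 2)]
  calc _ ≤ p * (Real.exp f * (1 + (-1) * s + 2 * (-1) ^ 2 * b ^ 2 + (-1) ^ 2 * b ^ 2 / 4)) +
        (1 - p) * (Real.exp f * (1 + r * s + 2 * r ^ 2 * b ^ 2 + r ^ 2 * b ^ 2 / 4)) :=
        add_le_add (mul_le_mul_of_nonneg_left k1 h0) (mul_le_mul_of_nonneg_left k2 hp1.le)
    _ = Real.exp f * (1 + ((1 - p) * r - p) * s +
        9 / 4 * b ^ 2 * (p + ((1 - p) * r) * r)) := by ring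
    _ ≤ Real.exp f * (1 + 9 * p * b ^ 2) := by
        refine mul_le_mul_of_nonneg_left ?_ (Real.exp_pos _).le
        rw [hr']
        have : p * r ≤ 3 * p := by nlinarith
        nlinarith [sq_nonneg b]
    _ ≤ Real.exp f * Real.exp (9 * p * b ^ 2) :=
        mul_le_mul_of_nonneg_left e3 (Real.exp_pos _).le
    _ = _ := mul_comm _ _

variable {ι : Type*} [Fintype ι] [DecidableEq ι]

/-- An exponential moment of a sum of martingale differences driven by independent bits. -/
theorem expect_exp_le {p : ℝ} (h0 : 0 ≤ p) (h1 : p ≤ 3 / 4) (lay : ι → ℕ)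
    (u : ι → (ι → Bool) → V) (b : ι → ℝ) (hb : ∀ c ω, ‖u c ω‖ ≤ b c) (hb6 : ∀ c, b c ≤ 1 / 6)
    (hu : ∀ c c', lay c ≤ lay c' → ∀ ω x, u c (Function.update ω c' x) = u c ω)
    (T : Finset ι) :
    expect p (fun ω => Real.exp √(1 + ‖∑ c ∈ T, drop p (ω c) • u c ω‖ ^ 2)) ≤
      Real.exp (1 + 9 * p * ∑ c ∈ T, b c ^ 2) := by
  induction T using Finset.induction_on_max_value lay with
  | empty =>
    have := expect_const_mul (p := p) (Real.exp 1) fun _ : ι → Bool => 1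
    rw [expect_one] at this
    simp at this
    simp [this]
  | insert a T ha hmax ih =>
    -- The bit `a` lies in the last layer present, and coefficients depend only on bits of strictly
    -- earlier layers; averaging over `a` thus affects a single sign factor, not the remaining sum.
    rw [expect_resample a]
    have hsum : ∀ ω x, ∑ c ∈ insert a T, drop p (Function.update ω a x c) •
        u c (Function.update ω a x) =
        ∑ c ∈ T, drop p (ω c) • u c ω + drop p x • u a ω := by
      intro ω x
      rw [Finset.sum_insert ha, add_comm, Function.update_self, hu a a le_rfl]
      congr 1
      refine Finset.sum_congr rfl fun c hc => ?_
      have hne : c ≠ a := fun h => ha (h ▸ hc)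
      rw [hu c a (hmax c hc), Function.update_of_ne hne]
    simp only [hsum]
    refine (expect_mono h0 (by linarith) fun ω =>
      two_point_exp_le h0 h1 _ _ (hb a ω) (hb6 a)).trans ?_
    rw [expect_const_mul]
    refine (mul_le_mul_of_nonneg_left ih (Real.exp_pos _).le).trans_eq ?_
    rw [← Real.exp_add, Finset.sum_insert ha]
    congr 1
    ring

/-- Markov's inequality for the exponential potential. The summand 1 is its logarithm at the origin.
-/
theorem prob_norm_ge_le {p : ℝ} (h0 : 0 ≤ p) (h1 : p ≤ 3 / 4) (lay : ι → ℕ)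
    (u : ι → (ι → Bool) → V) (b : ι → ℝ) (hb : ∀ c ω, ‖u c ω‖ ≤ b c) (hb6 : ∀ c, b c ≤ 1 / 6)
    (hu : ∀ c c', lay c ≤ lay c' → ∀ ω x, u c (Function.update ω c' x) = u c ω) (R : ℝ) :
    prob p {ω | R ≤ ‖∑ c, drop p (ω c) • u c ω‖} ≤
      Real.exp (1 + 9 * p * ∑ c, b c ^ 2 - R) := by
  refine (prob_le_of_expect h0 (by linarith)
    (F := fun ω => Real.exp √(1 + ‖∑ c, drop p (ω c) • u c ω‖ ^ 2))
    (fun ω => (Real.exp_pos _).le) (Real.exp_pos R) fun ω hω => ?_).trans ?_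
  · refine Real.exp_le_exp.2 (le_trans hω (Real.le_sqrt_of_sq_le (by linarith)))
  · rw [← Real.exp_neg]
    refine (mul_le_mul_of_nonneg_left (expect_exp_le h0 h1 lay u b hb hb6 hu Finset.univ)
      (Real.exp_pos _).le).trans_eq ?_
    rw [← Real.exp_add]
    congr 1
    ring

end Martingale

/-! ### Propagation of layerwise perturbations -/

section Forward

variable {d : ℕ} {h : ℕ → ℕ}

/-- The map from the pre-activation vector of layer `i` to that of layer `j`, for `i ≤ j`. -/
def fwd (θ : Params d h) (i : ℕ) : (j : ℕ) → E (h i) → E (h j)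
  | 0 => fun v => if e : i = 0 then e ▸ v else 0
  | j + 1 => fun v => if e : i = j + 1 then e ▸ v else layer θ j (fwd θ i j v)

theorem fwd_self (θ : Params d h) (i : ℕ) (v : E (h i)) : fwd θ i i v = v := by
  cases i <;> simp [fwd]

theorem fwd_succ (θ : Params d h) {i j : ℕ} (hij : i ≤ j) (v : E (h i)) :
    fwd θ i (j + 1) v = layer θ j (fwd θ i j v) := by
  simp [fwd, show i ≠ j + 1 by omega]

/-- Naming the target layer lets the source vary while the target space stays fixed, as the
telescoping argument requires. -/
theorem comp_eq_fwd (θ : Params d h) (i n : ℕ) : comp θ i n = fwd θ i (i + n) := by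
  induction n with
  | zero => funext v; exact (fwd_self θ i v).symm
  | succ n ih =>
    funext v
    rw [comp, ih]
    exact (fwd_succ θ (Nat.le_add_right i n) v).symm

theorem fwd_layer (θ : Params d h) {i j : ℕ} (hij : i < j) (v : E (h i)) :
    fwd θ (i + 1) j (layer θ i v) = fwd θ i j v := by
  induction j, hij using Nat.le_induction with
  | base => rw [fwd_self, fwd_succ θ le_rfl, fwd_self]
  | succ j hij ih => rw [fwd_succ θ hij, ih, fwd_succ θ (by omega)]

theorem fwd_pre (θ : Params d h) (x : E (h 0)) {i j : ℕ} (hij : i ≤ j) :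
    fwd θ i j (pre θ x i) = pre θ x j := by
  induction j, hij using Nat.le_induction with
  | base => exact fwd_self θ i _
  | succ j hij ih => rw [fwd_succ θ hij, ih]; rfl

theorem layer_smul (θ : Params d h) {k : ℕ} {a : ℝ} (ha : 0 ≤ a) (v : E (h k)) :
    layer θ k (a • v) = a • layer θ k v := by
  by_cases hk : k < d
  · rw [layer_of_lt θ hk, layer_of_lt θ hk, act_smul ha, mulE_smul_right]
  · simp [layer, hk]

theorem fwd_smul (θ : Params d h) {i j : ℕ} (hij : i ≤ j) {a : ℝ} (ha : 0 ≤ a) (v : E (h i)) :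
    fwd θ i j (a • v) = a • fwd θ i j v := by
  induction j, hij using Nat.le_induction with
  | base => rw [fwd_self, fwd_self]
  | succ j hij ih => rw [fwd_succ θ hij, ih, fwd_succ θ hij, layer_smul θ ha]

/-- Euler's identity for positively homogeneous functions. -/
theorem fderiv_apply_self_of_homogeneous {V W : Type*} [NormedAddCommGroup V] [NormedSpace ℝ V]
    [NormedAddCommGroup W] [NormedSpace ℝ W] {f : V → W}
    (hf : ∀ a : ℝ, 0 ≤ a → ∀ v, f (a • v) = a • f v) {x : V} (hx : DifferentiableAt ℝ f x) :
    fderiv ℝ f x x = f x := by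
  have h1 : HasDerivAt (fun t : ℝ => t • x) x 1 := by
    simpa using (hasDerivAt_id (1 : ℝ)).smul_const x
  have h2 : HasDerivAt (fun t : ℝ => f (t • x)) (fderiv ℝ f x x) 1 := by
    have hx' : HasFDerivAt f (fderiv ℝ f x) ((1 : ℝ) • x) := by
      rw [one_smul]
      exact hx.hasFDerivAt
    exact hx'.comp_hasDerivAt (1 : ℝ) h1
  have h3 : HasDerivAt (fun t : ℝ => f (t • x)) (f x) 1 := by
    have : HasDerivAt (fun t : ℝ => t • f x) (f x) 1 := by
      simpa using (hasDerivAt_id (1 : ℝ)).smul_const (f x)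
    refine this.congr_of_eventuallyEq ?_
    filter_upwards [lt_mem_nhds (zero_lt_one (α := ℝ))] with t ht
    exact hf t ht.le x
  exact h2.unique h3

/-- The derivative of the map from layer `i` to layer `j` at the vector computed from `x`. -/
def fwdDeriv (θ : Params d h) (x : E (h 0)) (i j : ℕ) : E (h i) →L[ℝ] E (h j) :=
  fderiv ℝ (fwd θ i j) (pre θ x i)

theorem jac_eq_fwdDeriv (θ : Params d h) (x : E (h 0)) (i n : ℕ) :
    jac θ x i n = fwdDeriv θ x i (i + n) := by
  rw [jac, comp_eq_fwd, fwdDeriv]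

theorem fwdDeriv_self (θ : Params d h) (x : E (h 0)) (i : ℕ) (v : E (h i)) :
    fwdDeriv θ x i i v = v := by
  have : fwd θ i i = id := funext fun v => fwd_self θ i v
  rw [fwdDeriv, this, fderiv_id]
  rfl

/-- Euler's identity. Differentiability comes from `hne`, because the derivative is zero by default
at other points. -/
theorem fwdDeriv_pre (θ : Params d h) (x : E (h 0)) {i j : ℕ} (hij : i ≤ j)
    (hne : fwdDeriv θ x i j (pre θ x i) ≠ 0) :
    fwdDeriv θ x i j (pre θ x i) = pre θ x j := by
  have hd : DifferentiableAt ℝ (fwd θ i j) (pre θ x i) := by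
    by_contra hd
    refine hne ?_
    rw [fwdDeriv, fderiv_zero_of_not_differentiableAt hd]
    rfl
  rw [fwdDeriv, fderiv_apply_self_of_homogeneous (fun a ha v => fwd_smul θ hij ha v) hd,
    fwd_pre θ x hij]

/-- Layerwise perturbations of a network whose linearizations add up to little change the vectors
of all layers by little, if the network is smooth enough. -/
theorem norm_pre_sub_le {θ θ' : Params d h} {x : E (h 0)} {Γ ρ : ℝ} (hd : 1 ≤ d) (hΓ : 0 ≤ Γ)
    (hρ : 3 * (d : ℝ) ≤ ρ) (h1 : pre θ' x 1 = pre θ x 1)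
    (hne : ∀ i, 1 ≤ i → i ≤ d → pre θ x i ≠ 0)
    (hsm : ∀ k j, 1 ≤ k → k + 1 ≤ j → j ≤ d →
      ∀ v, (v = pre θ' x (k + 1) ∨ v = layer θ k (pre θ' x k)) →
      ‖fwd θ (k + 1) j v - fwdDeriv θ x (k + 1) j v‖ ≤
        ‖v - pre θ x (k + 1)‖ * ‖pre θ x j‖ / (ρ * ‖pre θ x (k + 1)‖))
    (nz : ∀ k, E (h (k + 1)))
    (hnz : ∀ k, 1 ≤ k → k < d → ‖pre θ' x k - pre θ x k‖ ≤ 3 * Γ * ‖pre θ x k‖ →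
      pre θ' x (k + 1) - layer θ k (pre θ' x k) = nz k)
    (hS : ∀ n j, n ≤ j → j ≤ d →
      ‖∑ k ∈ Finset.range n, if 1 ≤ k then fwdDeriv θ x (k + 1) j (nz k) else 0‖ ≤
        Γ * ‖pre θ x j‖) :
    ∀ j, 1 ≤ j → j ≤ d → ‖pre θ' x j - pre θ x j‖ ≤ 3 * Γ * ‖pre θ x j‖ := by
  have hd' : (1 : ℝ) ≤ d := by exact_mod_cast hd
  have hρ0 : 0 < ρ := by linarith
  -- The second bound concerns a clean layer applied to the noisy vector. It is carried along
  -- because smoothness is invoked at both kinds of vectors.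
  suffices H : ∀ k, k + 1 ≤ d → ‖pre θ' x (k + 1) - pre θ x (k + 1)‖ ≤
      3 * Γ * ‖pre θ x (k + 1)‖ ∧
      ‖layer θ k (pre θ' x k) - pre θ x (k + 1)‖ ≤ 3 * Γ * ‖pre θ x (k + 1)‖ by
    intro j hj hjd
    obtain ⟨k, rfl⟩ : ∃ k, j = k + 1 := ⟨j - 1, by omega⟩
    exact (H k hjd).1
  intro k
  induction k using Nat.strong_induction_on with
  | _ k ih =>
  intro hkd
  have hx0 : 0 ≤ 3 * Γ * ‖pre θ x (k + 1)‖ := by positivity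
  rcases Nat.eq_zero_or_pos k with rfl | hk
  · have e : layer θ 0 (pre θ' x 0) = pre θ x 1 := rfl
    rw [h1, e]
    simpa using hx0
  set j := k + 1 with hj
  set S : ℕ → E (h j) := fun n =>
    ∑ k ∈ Finset.range n, if 1 ≤ k then fwdDeriv θ x (k + 1) j (nz k) else 0 with hSdef
  -- Telescoping over the layer at which the noise stops. Each step adds one linearized noise term
  -- and two linearization errors of at most `3 * Γ / ρ * ‖pre θ x j‖`.
  have claim : ∀ n, n + 1 ≤ k → ‖fwd θ (n + 1) j (pre θ' x (n + 1)) - pre θ x j - S (n + 1)‖ ≤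
      n * (6 * Γ / ρ * ‖pre θ x j‖) := by
    intro n
    induction n with
    | zero =>
      intro _
      rw [h1, fwd_pre θ x (by omega)]
      simp [hSdef]
    | succ n ihn =>
      intro hn
      have hi := ihn (by omega)
      obtain ⟨i1, i2⟩ := ih (n + 1) (by omega) (by omega)
      have hxn : 0 < ‖pre θ x (n + 1 + 1)‖ := norm_pos_iff.2 (hne _ (by omega) (by omega))
      have hbd : ∀ v : E (h (n + 1 + 1)), ‖v - pre θ x (n + 1 + 1)‖ ≤
          3 * Γ * ‖pre θ x (n + 1 + 1)‖ →
          ‖v - pre θ x (n + 1 + 1)‖ * ‖pre θ x j‖ / (ρ * ‖pre θ x (n + 1 + 1)‖) ≤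
            3 * Γ / ρ * ‖pre θ x j‖ := by
        intro v hv
        rw [div_le_iff₀ (by positivity)]
        calc _ ≤ 3 * Γ * ‖pre θ x (n + 1 + 1)‖ * ‖pre θ x j‖ :=
              mul_le_mul_of_nonneg_right hv (norm_nonneg _)
          _ = _ := by field_simp
      have s1 := (hsm (n + 1) j (by omega) (by omega) hkd _ (Or.inl rfl)).trans (hbd _ i1)
      have s2 := (hsm (n + 1) j (by omega) (by omega) hkd _ (Or.inr rfl)).trans (hbd _ i2)
      have i3 := (ih n (by omega) (by omega)).1
      have hz := hnz (n + 1) (by omega) (by omega) i3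
      have e1 : S (n + 1 + 1) = S (n + 1) + fwdDeriv θ x (n + 1 + 1) j (nz (n + 1)) := by
        simp only [hSdef]
        rw [Finset.sum_range_succ]
        simp
      rw [← fwd_layer θ (by omega)] at hi
      rw [e1, ← hz, map_sub]
      set a := fwd θ (n + 1 + 1) j (pre θ' x (n + 1 + 1))
      set a' := fwdDeriv θ x (n + 1 + 1) j (pre θ' x (n + 1 + 1))
      set b := fwd θ (n + 1 + 1) j (layer θ (n + 1) (pre θ' x (n + 1)))
      set b' := fwdDeriv θ x (n + 1 + 1) j (layer θ (n + 1) (pre θ' x (n + 1)))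
      have e2 : a - pre θ x j - (S (n + 1) + (a' - b')) =
          (b - pre θ x j - S (n + 1)) + (a - a') - (b - b') := by abel
      rw [e2]
      refine (norm_sub_le _ _).trans ((add_le_add (norm_add_le _ _) le_rfl).trans ?_)
      push_cast
      have : 6 * Γ / ρ * ‖pre θ x j‖ = 3 * Γ / ρ * ‖pre θ x j‖ + 3 * Γ / ρ * ‖pre θ x j‖ := by
        ring
      linarith
  obtain ⟨n, rfl⟩ : ∃ n, k = n + 1 := ⟨k - 1, by omega⟩
  have hc := claim n le_rfl
  rw [fwd_succ θ le_rfl, fwd_self] at hc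
  -- As `ρ ≥ 3 d`, all linearization errors together cost `2 Γ`. The linear part costs `Γ`, which
  -- closes the induction at `3 Γ`.
  have hfac : n * (6 * Γ / ρ * ‖pre θ x j‖) ≤ 2 * Γ * ‖pre θ x j‖ := by
    have : (n : ℝ) * 6 / ρ ≤ 2 := by
      rw [div_le_iff₀ hρ0]
      have : (n : ℝ) + 2 ≤ d := by exact_mod_cast hkd
      linarith
    calc n * (6 * Γ / ρ * ‖pre θ x j‖) = (n * 6 / ρ) * (Γ * ‖pre θ x j‖) := by ring
      _ ≤ 2 * (Γ * ‖pre θ x j‖) := by gcongr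
      _ = _ := by ring
  have hS1 := hS (n + 1) j (by omega) hkd
  have hS2 := hS (n + 1 + 1) j le_rfl hkd
  have e1 : S (n + 1 + 1) = S (n + 1) + nz (n + 1) := by
    simp only [hSdef]
    rw [Finset.sum_range_succ, if_pos (by omega : 1 ≤ n + 1)]
    exact congrArg _ (fwdDeriv_self θ x (n + 1 + 1) _)
  change ‖S (n + 1)‖ ≤ _ at hS1
  change ‖S (n + 1 + 1)‖ ≤ _ at hS2
  have hz := hnz (n + 1) (by omega) (by omega) (ih n (by omega) (by omega)).1
  constructor
  · have e2 : pre θ' x j - pre θ x j =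
        (layer θ (n + 1) (pre θ' x (n + 1)) - pre θ x j - S (n + 1)) + S (n + 1 + 1) := by
      rw [e1, ← hz]
      abel
    rw [e2]
    refine (norm_add_le _ _).trans ?_
    linarith
  · have e2 : layer θ (n + 1) (pre θ' x (n + 1)) - pre θ x j =
        (layer θ (n + 1) (pre θ' x (n + 1)) - pre θ x j - S (n + 1)) + S (n + 1) := by
      abel
    rw [e2]
    refine (norm_add_le _ _).trans ?_
    linarith

end Forward

/-! ### Columns, the Frobenius norm and ReLU -/

section Norms

theorem frob_sq {n m : ℕ} (A : Matrix (Fin m) (Fin n) ℝ) :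
    frob A ^ 2 = ∑ c, colNorm A c ^ 2 := by
  rw [frob, Real.sq_sqrt (by positivity), Finset.sum_comm]
  exact Finset.sum_congr rfl fun c _ => (Real.sq_sqrt (by positivity)).symm

theorem colNorm_nonneg {n m : ℕ} (A : Matrix (Fin m) (Fin n) ℝ) (c : Fin n) : 0 ≤ colNorm A c :=
  Real.sqrt_nonneg _

theorem norm_mulE_single {n m : ℕ} (A : Matrix (Fin m) (Fin n) ℝ) (c : Fin n) :
    ‖mulE A (EuclideanSpace.single c 1)‖ = colNorm A c := by
  rw [EuclideanSpace.norm_eq, colNorm]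
  simp [mulE_apply]

theorem mulE_eq_sum {n m : ℕ} (A : Matrix (Fin m) (Fin n) ℝ) (v : Fin n → ℝ) :
    mulE A (WithLp.toLp 2 v) = ∑ c, v c • mulE A (EuclideanSpace.single c 1) := by
  ext r
  simp [mulE_apply, mul_comm]

theorem norm_relu_le {n : ℕ} (v : E n) : ‖relu v‖ ≤ ‖v‖ := by
  rw [EuclideanSpace.norm_eq, EuclideanSpace.norm_eq]
  refine Real.sqrt_le_sqrt (Finset.sum_le_sum fun i _ => ?_)
  refine pow_le_pow_left₀ (norm_nonneg _) ?_ 2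
  rw [relu_apply, Real.norm_eq_abs, Real.norm_eq_abs, abs_of_nonneg (le_max_right _ _)]
  exact max_le (le_abs_self _) (abs_nonneg _)

theorem norm_relu_sub_le {n : ℕ} (v w : E n) : ‖relu v - relu w‖ ≤ ‖v - w‖ := by
  rw [EuclideanSpace.norm_eq, EuclideanSpace.norm_eq]
  refine Real.sqrt_le_sqrt (Finset.sum_le_sum fun i _ => ?_)
  refine pow_le_pow_left₀ (norm_nonneg _) ?_ 2
  simp only [PiLp.sub_apply, relu_apply, Real.norm_eq_abs]
  exact abs_max_sub_max_le_abs _ _ _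

end Norms

/-! ### The noise of dropout and its concentration -/

section Dropout

variable {d : ℕ} {h : ℕ → ℕ}

/-- The point with parameter `t` of the segment from the dropped-out network to the network. -/
def mix (p : ℝ) (θ : Params d h) (ω : Mask d h) (t : ℝ) : Params d h :=
  t • θ + (1 - t) • dropUpTo p θ ω d

variable {p t : ℝ} {θ : Params d h} {ω : Mask d h} {x : E (h 0)}

theorem mix_zero (hd : 0 < d) : mix p θ ω t ⟨0, hd⟩ = θ ⟨0, hd⟩ := by
  simp only [mix, Pi.add_apply, Pi.smul_apply, dropUpTo]
  rw [if_neg (by simp)]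
  exact (add_smul t (1 - t) (θ ⟨0, hd⟩)).symm.trans (by simp)

theorem mix_apply (k : Fin d) (hk : 1 ≤ (k : ℕ)) (r : Fin (h (k + 1))) (c : Fin (h k)) :
    mix p θ ω t k r c = (1 + (1 - t) * drop p (ω ⟨k, c⟩)) * θ k r c := by
  have : 2 ≤ (k : ℕ) + 1 ∧ (k : ℕ) + 1 ≤ d := ⟨by omega, k.2⟩
  simp only [mix, Pi.add_apply, Pi.smul_apply, dropUpTo, this, and_self, if_true,
    Matrix.add_apply, Matrix.smul_apply, dropLayer, Matrix.of_apply, smul_eq_mul, drop]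
  ring

theorem hatX_self {i : ℕ} : hatX p θ ω x i i t = pre (mix p θ ω t) x i := by
  refine pre_congr x fun k hk => ?_
  have h1 : (k : ℕ) + 1 ≤ i := hk
  have h2 : (k : ℕ) + 1 ≤ d := k.2
  simp only [mix, Pi.add_apply, Pi.smul_apply, dropUpTo, h1, h2]

theorem hatX_pred {k : ℕ} (hk : k < d) :
    hatX p θ ω x (k + 1) k t = layer θ k (pre (mix p θ ω t) x k) := by
  rw [hatX, pre_succ _ x hk, layer_of_lt θ hk]
  have h1 : pre (t • θ + (1 - t) • dropUpTo p θ ω k) x k = pre (mix p θ ω t) x k :=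
    hatX_self
  rw [h1]
  congr 1
  simp only [Pi.add_apply, Pi.smul_apply, dropUpTo]
  rw [if_neg (by simp)]
  exact (add_smul t (1 - t) (θ ⟨k, hk⟩)).symm.trans (by simp)

/-- Adaptedness: the vector of layer `k` depends only on bits of matrices with index below `k`. -/
theorem pre_mix_update {k : ℕ} (c : (k : Fin d) × Fin (h k)) (hk : k ≤ c.1) (b : Bool) :
    pre (mix p θ (Function.update ω c b) t) x k = pre (mix p θ ω t) x k := by
  refine pre_congr x fun i hi => ?_
  by_cases h0 : 1 ≤ (i : ℕ)
  · ext r j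
    rw [mix_apply i h0, mix_apply i h0, Function.update_of_ne]
    rintro rfl
    simp at hk
    omega
  · have : i = ⟨0, by omega⟩ := Fin.ext (by simp; omega)
    rw [this, mix_zero, mix_zero]

/-- The change that dropping the columns of the matrix of layer `k + 1` causes, with activations
cut off at `T k`. -/
def noise (p : ℝ) (θ : Params d h) (ω : Mask d h) (x : E (h 0)) (t : ℝ) (T : ℕ → ℝ) (k : ℕ) :
    E (h (k + 1)) :=
  if hk : k < d then
    mulE (θ ⟨k, hk⟩) (WithLp.toLp 2 fun c =>
      drop p (ω ⟨⟨k, hk⟩, c⟩) * ((1 - t) * min (relu (pre (mix p θ ω t) x k) c) (T k)))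
  else 0

/-- The cut-off gives the martingale increments deterministic bounds. It is inactive whenever the
activations obey the flatness bound, and then the truncated noise is the true one. -/
theorem pre_mix_succ_sub {T : ℕ → ℝ} {k : ℕ} (hk1 : 1 ≤ k) (hk : k < d)
    (hT : ∀ c, relu (pre (mix p θ ω t) x k) c ≤ T k) :
    pre (mix p θ ω t) x (k + 1) - layer θ k (pre (mix p θ ω t) x k) =
      noise p θ ω x t T k := by
  rw [pre_succ _ x hk, layer_of_lt θ hk, noise, dif_pos hk, act_of_pos hk1]
  ext r
  simp only [PiLp.sub_apply, mulE_apply, ← Finset.sum_sub_distrib]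
  refine Finset.sum_congr rfl fun c _ => ?_
  rw [mix_apply _ hk1, min_eq_left (hT c)]
  ring

theorem sum_fin_eq_sum_range {V : Type*} [AddCommMonoid V] {n : ℕ} (hn : n ≤ d) (F : ℕ → V) :
    ∑ k : Fin d, (if (k : ℕ) < n then F k else 0) = ∑ k ∈ Finset.range n, F k := by
  rw [← Finset.sum_range (fun k => if k < n then F k else 0), ← Finset.sum_filter]
  congr 1
  ext k
  simp
  omega

/-- Concentration of the linearized effect of dropout. -/
theorem prob_noise_le {K₂ g R : ℝ} {T : ℕ → ℝ} {n j : ℕ} (h0 : 0 < p) (h1 : p ≤ 3 / 4)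
    (hK : 0 < K₂) (ht : t ∈ Icc (0 : ℝ) 1) (hn : n ≤ d) (hg : 0 < g) (hx : pre θ x j ≠ 0)
    (hT : ∀ k, 0 ≤ T k)
    (hcol : ∀ k : Fin d, 1 ≤ (k : ℕ) → ∀ c, colNorm (θ k) c ≤ K₂ * √p * frob (θ k))
    (hf : ∀ k : Fin d, 1 ≤ (k : ℕ) → 0 < frob (θ k))
    (hJ : ∀ k : Fin d, 1 ≤ (k : ℕ) → (k : ℕ) < n →
      T k * ‖fwdDeriv θ x (k + 1) j‖ * frob (θ k) ≤
        g * ‖pre θ x j‖ * (6 * (K₂ + 1) * √p)⁻¹) :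
    prob p {ω : Mask d h | g * R * ‖pre θ x j‖ ≤ ‖∑ k ∈ Finset.range n,
      if 1 ≤ k then fwdDeriv θ x (k + 1) j (noise p θ ω x t T k) else 0‖} ≤
      Real.exp (1 + d / 4 - R) := by
  have hx0 : 0 < ‖pre θ x j‖ := norm_pos_iff.2 hx
  have hgx : 0 < g * ‖pre θ x j‖ := mul_pos hg hx0
  have hsp : 0 < √p := Real.sqrt_pos.2 h0
  let u : ((k : Fin d) × Fin (h k)) → Mask d h → E (h j) := fun c ω =>
    if 1 ≤ (c.1 : ℕ) ∧ (c.1 : ℕ) < n then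
      (g * ‖pre θ x j‖)⁻¹ • ((1 - t) * min (relu (pre (mix p θ ω t) x c.1) c.2) (T c.1)) •
        fwdDeriv θ x (c.1 + 1) j (mulE (θ c.1) (EuclideanSpace.single c.2 1))
    else 0
  -- The factor 6 and column balance give the bound 1/6 on increments. Using `K₂ + 1` instead of
  -- `K₂` makes the factor at least 1, as the variance bound below requires.
  let b : ((k : Fin d) × Fin (h k)) → ℝ := fun c =>
    if 1 ≤ (c.1 : ℕ) ∧ (c.1 : ℕ) < n then
      (6 * (K₂ + 1) * √p)⁻¹ * (colNorm (θ c.1) c.2 / frob (θ c.1)) else 0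
  have hb : ∀ c ω, ‖u c ω‖ ≤ b c := by
    rintro ⟨k, c⟩ ω
    simp only [u, b]
    split_ifs with hc
    · have hfk := hf k hc.1
      have hm : |(1 - t) * min (relu (pre (mix p θ ω t) x k) c) (T k)| ≤ T k := by
        have hr : 0 ≤ relu (pre (mix p θ ω t) x k) c := le_max_right _ _
        have hm0 : 0 ≤ min (relu (pre (mix p θ ω t) x k) c) (T k) := le_min hr (hT k)
        rw [abs_of_nonneg (mul_nonneg (by linarith [ht.2]) hm0)]
        calc _ ≤ 1 * min (relu (pre (mix p θ ω t) x k) c) (T k) :=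
              mul_le_mul_of_nonneg_right (by linarith [ht.1]) hm0
          _ ≤ T k := by rw [one_mul]; exact min_le_right _ _
      rw [norm_smul, norm_smul, Real.norm_eq_abs, Real.norm_eq_abs,
        abs_of_pos (inv_pos.2 hgx), inv_mul_le_iff₀ hgx]
      have hJc := (fwdDeriv θ x (k + 1) j).le_opNorm (mulE (θ k) (EuclideanSpace.single c 1))
      rw [norm_mulE_single] at hJc
      calc _ ≤ T k * (‖fwdDeriv θ x (k + 1) j‖ * colNorm (θ k) c) :=
            mul_le_mul hm hJc (norm_nonneg _) (hT k)
        _ = T k * ‖fwdDeriv θ x (k + 1) j‖ * frob (θ k) * (colNorm (θ k) c / frob (θ k)) := by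
            field_simp
        _ ≤ g * ‖pre θ x j‖ * (6 * (K₂ + 1) * √p)⁻¹ * (colNorm (θ k) c / frob (θ k)) :=
            mul_le_mul_of_nonneg_right (hJ k hc.1 hc.2)
              (div_nonneg (colNorm_nonneg _ _) hfk.le)
        _ = _ := by ring
    · simp
  have hb6 : ∀ c, b c ≤ 1 / 6 := by
    rintro ⟨k, c⟩
    simp only [b]
    split_ifs with hc
    · have hfk := hf k hc.1
      have := (div_le_iff₀ hfk).2 (hcol k hc.1 c)
      rw [inv_mul_le_iff₀ (by positivity)]
      nlinarith
    · norm_num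
  have hu : ∀ c c', (c.1 : ℕ) ≤ (c'.1 : ℕ) → ∀ ω y, u c (Function.update ω c' y) = u c ω := by
    rintro ⟨k, c⟩ c' hcc ω y
    simp only [u]
    rw [pre_mix_update c' hcc y]
  -- The squared column norms add up to the squared Frobenius norm, so each layer contributes at
  -- most `1 / (36 p)`, whatever its width.
  have hsumb : 9 * p * ∑ c, b c ^ 2 ≤ d / 4 := by
    rw [Fintype.sum_sigma]
    have hk : ∀ k : Fin d, ∑ c, b ⟨k, c⟩ ^ 2 ≤ (36 * p)⁻¹ := by
      intro k
      simp only [b]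
      split_ifs with hc
      · have hfk := hf k hc.1
        simp only [mul_pow, div_pow, ← Finset.mul_sum, ← Finset.sum_div, ← frob_sq]
        rw [div_self (by positivity), mul_one, inv_pow]
        refine inv_anti₀ (by positivity) ?_
        rw [mul_pow, mul_pow, Real.sq_sqrt h0.le]
        nlinarith [mul_pos hK h0]
      · simp only [ne_eq, OfNat.ofNat_ne_zero, not_false_eq_true, zero_pow,
          Finset.sum_const_zero]
        positivity
    calc 9 * p * ∑ k : Fin d, ∑ c, b ⟨k, c⟩ ^ 2 ≤ 9 * p * ∑ _k : Fin d, (36 * p)⁻¹ := by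
          gcongr with k
          exact hk k
      _ = d / 4 := by
          simp
          field_simp
          ring
  have hsum : ∀ ω : Mask d h, ∑ c, drop p (ω c) • u c ω = (g * ‖pre θ x j‖)⁻¹ •
      ∑ k ∈ Finset.range n,
        if 1 ≤ k then fwdDeriv θ x (k + 1) j (noise p θ ω x t T k) else 0 := by
    intro ω
    rw [Fintype.sum_sigma, ← sum_fin_eq_sum_range hn, Finset.smul_sum]
    refine Finset.sum_congr rfl fun k _ => ?_
    by_cases hc : 1 ≤ (k : ℕ) ∧ (k : ℕ) < n
    · simp only [u, hc, and_self, if_true]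
      rw [noise, dif_pos k.2, mulE_eq_sum, map_sum, Finset.smul_sum]
      refine Finset.sum_congr rfl fun c _ => ?_
      simp only [map_smul, smul_smul]
      congr 1
      simp only [Fin.eta]
      ring
    · have h2 : (if (k : ℕ) < n then if 1 ≤ (k : ℕ) then
          fwdDeriv θ x (k + 1) j (noise p θ ω x t T k) else 0 else 0) = 0 := by
        split_ifs with a b
        · exact absurd ⟨b, a⟩ hc
        · rfl
        · rfl
      rw [h2]
      simp [u, hc]
  have key := prob_norm_ge_le h0.le h1 (fun c : (k : Fin d) × Fin (h k) => (c.1 : ℕ)) u b hb hb6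
    hu R
  refine le_trans (le_of_eq ?_) (key.trans (Real.exp_le_exp.2 (by linarith)))
  congr 1
  ext ω
  simp only [mem_ofPred_eq, hsum, norm_smul, Real.norm_eq_abs, abs_of_pos (inv_pos.2 hgx)]
  rw [le_inv_mul_iff₀ hgx]
  constructor <;> intro hh <;> linarith

end Dropout

/-! ### What the noise stability quantities give -/

section Cushions

variable {d m : ℕ} {h : ℕ → ℕ} {θ : Params d h} {X : Fin m → E (h 0)}

theorem minWidth_le {k : ℕ} (hk : 1 ≤ k) (hkd : k < d) : minWidth d h ≤ h k := by
  have : minWidth d h ≤ h (k - 1 + 1) :=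
    ciInf_le (f := fun k : Fin (d - 1) => h (k + 1)) (OrderBot.bddBelow _) ⟨k - 1, by omega⟩
  rwa [Nat.sub_add_cancel hk] at this

theorem norm_pre_le_actContraction (s : Fin m) {k : ℕ} (hk : 1 ≤ k) (hkd : k < d)
    (hne : relu (pre θ (X s) k) ≠ 0) :
    ‖pre θ (X s) k‖ ≤ actContraction θ X * ‖relu (pre θ (X s) k)‖ := by
  obtain ⟨k, rfl⟩ : ∃ i, k = i + 1 := ⟨k - 1, by omega⟩
  have := le_ciSup (f := fun z : Fin m × Fin (d - 1) =>
    ‖pre θ (X z.1) (z.2 + 1)‖ / ‖relu (pre θ (X z.1) (z.2 + 1))‖) (Set.finite_range _).bddAbove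
    (s, ⟨k, by omega⟩)
  exact (div_le_iff₀ (norm_pos_iff.2 hne)).1 this

/-- By Euler's identity the interlayer cushion compares `pre θ (X s) j` with `pre θ (X s) (k + 1)`,
and the layer cushion compares the latter with the activations of layer `k`; the norm of layer `k +
1` cancels in the product. Division by zero yields zero, so positive cushions force nonzero
denominators. -/
theorem cushion_bounds (hμ : 0 < minCushion θ X) (s : Fin m) {k j : ℕ} (hk : 1 ≤ k)
    (hkj : k + 1 ≤ j) (hjd : j ≤ d) :
    relu (pre θ (X s) k) ≠ 0 ∧ 0 < frob (θ ⟨k, by omega⟩) ∧ pre θ (X s) j ≠ 0 ∧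
      ‖fwdDeriv θ (X s) (k + 1) j‖ * frob (θ ⟨k, by omega⟩) * ‖relu (pre θ (X s) k)‖ *
        minCushion θ X ≤ ‖pre θ (X s) j‖ := by
  obtain ⟨k, rfl⟩ : ∃ i, k = i + 1 := ⟨k - 1, by omega⟩
  obtain ⟨n, rfl⟩ : ∃ n, j = k + 2 + n := ⟨j - (k + 2), by omega⟩
  have hkd : k + 1 < d := by omega
  have h1 : minCushion θ X ≤ layerCushion θ X ⟨k + 1, hkd⟩ *
      minInterlayerCushion θ X (k + 2) :=
    ciInf_le (Set.finite_range _).bddBelow (⟨k, by omega⟩ : Fin (d - 1))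
  have hL0 : 0 ≤ layerCushion θ X ⟨k + 1, hkd⟩ := Real.iInf_nonneg fun s =>
    div_nonneg (norm_nonneg _) (mul_nonneg (Real.sqrt_nonneg _) (norm_nonneg _))
  have hM0 : 0 ≤ minInterlayerCushion θ X (k + 2) := Real.iInf_nonneg fun n =>
    Real.iInf_nonneg fun s => by positivity
  have hpos := hμ.trans_le h1
  have hLp : 0 < layerCushion θ X ⟨k + 1, hkd⟩ := by
    by_contra hc
    rw [le_antisymm (not_lt.1 hc) hL0, zero_mul] at hpos
    exact lt_irrefl _ hpos
  have hMp : 0 < minInterlayerCushion θ X (k + 2) := by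
    by_contra hc
    rw [le_antisymm (not_lt.1 hc) hM0, mul_zero] at hpos
    exact lt_irrefl _ hpos
  have hL : layerCushion θ X ⟨k + 1, hkd⟩ ≤ ‖pre θ (X s) (k + 2)‖ /
      (frob (θ ⟨k + 1, hkd⟩) * ‖relu (pre θ (X s) (k + 1))‖) := by
    rw [pre_succ θ (X s) hkd]
    exact ciInf_le (Set.finite_range _).bddBelow s
  have hM1 : minInterlayerCushion θ X (k + 2) ≤ interlayerCushion θ X (k + 2) n :=
    ciInf_le (f := fun n : Fin (d - (k + 2) + 1) => interlayerCushion θ X (k + 2) n)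
      (Set.finite_range _).bddBelow ⟨n, by omega⟩
  have hM2 : interlayerCushion θ X (k + 2) n ≤
      ‖fwdDeriv θ (X s) (k + 2) (k + 2 + n) (pre θ (X s) (k + 2))‖ /
      (‖fwdDeriv θ (X s) (k + 2) (k + 2 + n)‖ * ‖pre θ (X s) (k + 2)‖) := by
    rw [← jac_eq_fwdDeriv]
    exact ciInf_le (Set.finite_range _).bddBelow s
  have hM := hM1.trans hM2
  have hr1 := hLp.trans_le hL
  have hr2 := hMp.trans_le hM
  have hJne : fwdDeriv θ (X s) (k + 2) (k + 2 + n) (pre θ (X s) (k + 2)) ≠ 0 := by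
    intro h0
    simp [h0] at hr2
  have hJ := fwdDeriv_pre θ (X s) (Nat.le_add_right (k + 2) n) hJne
  rw [hJ] at hM hr2 hJne
  have hfr : 0 < frob (θ ⟨k + 1, hkd⟩) * ‖relu (pre θ (X s) (k + 1))‖ := by
    rcases (mul_nonneg (Real.sqrt_nonneg _) (norm_nonneg _) :
      0 ≤ frob (θ ⟨k + 1, hkd⟩) * ‖relu (pre θ (X s) (k + 1))‖).eq_or_lt with h0 | h0
    · rw [← h0, div_zero] at hr1
      exact absurd hr1 (lt_irrefl _)
    · exact h0
  have hJx : 0 < ‖fwdDeriv θ (X s) (k + 2) (k + 2 + n)‖ * ‖pre θ (X s) (k + 2)‖ := by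
    rcases (mul_nonneg (norm_nonneg _) (norm_nonneg _) :
      0 ≤ ‖fwdDeriv θ (X s) (k + 2) (k + 2 + n)‖ * ‖pre θ (X s) (k + 2)‖).eq_or_lt with h0 | h0
    · rw [← h0, div_zero] at hr2
      exact absurd hr2 (lt_irrefl _)
    · exact h0
  have hf : 0 < frob (θ ⟨k + 1, hkd⟩) := by
    by_contra hc
    have := mul_nonpos_of_nonpos_of_nonneg (not_lt.1 hc)
      (norm_nonneg (relu (pre θ (X s) (k + 1))))
    linarith
  refine ⟨fun h0 => by simp [h0] at hfr, hf, hJne, ?_⟩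
  have hx2 : ‖pre θ (X s) (k + 2)‖ ≠ 0 := fun h0 => by simp [h0] at hJx
  calc _ ≤ ‖fwdDeriv θ (X s) (k + 2) (k + 2 + n)‖ * frob (θ ⟨k + 1, hkd⟩) *
        ‖relu (pre θ (X s) (k + 1))‖ * (‖pre θ (X s) (k + 2)‖ /
      (frob (θ ⟨k + 1, hkd⟩) * ‖relu (pre θ (X s) (k + 1))‖) * (‖pre θ (X s) (k + 2 + n)‖ /
      (‖fwdDeriv θ (X s) (k + 2) (k + 2 + n)‖ * ‖pre θ (X s) (k + 2)‖))) := by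
        refine mul_le_mul_of_nonneg_left (h1.trans (mul_le_mul hL hM hM0 hr1.le)) ?_
        have := hf.le
        positivity
    _ = _ := by
        have a1 := hfr.ne'
        have a2 := hJx.ne'
        have a3 := left_ne_zero_of_mul a2
        have a4 := left_ne_zero_of_mul a1
        have a5 := right_ne_zero_of_mul a1
        field_simp

end Cushions

/-! ### Lipschitz dependence on the parameter of the segment -/

section Lipschitz

variable {d : ℕ} {h : ℕ → ℕ}

theorem norm_mulE_le {n m : ℕ} (A : Matrix (Fin m) (Fin n) ℝ) (v : E n) :
    ‖mulE A v‖ ≤ opNorm A * ‖v‖ :=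
  (LinearMap.toContinuousLinearMap (Matrix.toLpLin 2 2 A)).le_opNorm v

theorem opNorm_nonneg {n m : ℕ} (A : Matrix (Fin m) (Fin n) ℝ) : 0 ≤ opNorm A := norm_nonneg _

theorem norm_mulE_le_of_scaled {n m : ℕ} {A B : Matrix (Fin m) (Fin n) ℝ} {e : Fin n → ℝ} {M : ℝ}
    (hM : 0 ≤ M) (he : ∀ c, |e c| ≤ M) (hB : ∀ r c, B r c = e c * A r c) (v : E n) :
    ‖mulE B v‖ ≤ opNorm A * (M * ‖v‖) := by
  have : mulE B v = mulE A (WithLp.toLp 2 fun c => e c * v c) := by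
    ext r
    simp only [mulE_apply, hB]
    exact Finset.sum_congr rfl fun c _ => by ring
  rw [this]
  refine (norm_mulE_le _ _).trans (mul_le_mul_of_nonneg_left ?_ (opNorm_nonneg _))
  rw [EuclideanSpace.norm_eq, EuclideanSpace.norm_eq]
  refine Real.sqrt_le_iff.2 ⟨by positivity, ?_⟩
  rw [mul_pow, Real.sq_sqrt (by positivity), Finset.mul_sum]
  refine Finset.sum_le_sum fun c _ => ?_
  simp only [Real.norm_eq_abs, abs_mul, mul_pow]
  exact mul_le_mul_of_nonneg_right (pow_le_pow_left₀ (abs_nonneg _) (he c) 2) (by positivity)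

theorem abs_drop_le {p : ℝ} (h0 : 0 ≤ p) (h1 : p ≤ 3 / 4) (b : Bool) : |drop p b| ≤ 3 := by
  cases b
  · have : drop p false = p / (1 - p) := by
      have : (1 - p) ≠ 0 := by linarith
      simp only [drop, Bool.false_eq_true, if_false]
      field_simp
      ring
    rw [this, abs_of_nonneg (div_nonneg h0 (by linarith)), div_le_iff₀ (by linarith)]
    linarith
  · simp [drop]

theorem norm_act_le {n k : ℕ} (v : E n) : ‖act k v‖ ≤ ‖v‖ := by
  cases k with
  | zero => exact le_rfl
  | succ k => exact norm_relu_le v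

theorem norm_act_sub_le {n k : ℕ} (v w : E n) : ‖act k v - act k w‖ ≤ ‖v - w‖ := by
  cases k with
  | zero => exact le_rfl
  | succ k => exact norm_relu_sub_le v w

/-- The vectors computed along the segment to the dropped-out network are Lipschitz functions of
the parameter of the segment. -/
theorem norm_pre_mix_sub_le {p a t t' : ℝ} {θ : Params d h} (ω : Mask d h) (x : E (h 0))
    (h0 : 0 ≤ p) (h1 : p ≤ 3 / 4) (ht : t ∈ Icc (0 : ℝ) 1) (ht' : t' ∈ Icc (0 : ℝ) 1)
    (ha : ∀ k, opNorm (θ k) ≤ a) {k : ℕ} (hk : k ≤ d) :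
    ‖pre (mix p θ ω t') x k‖ ≤ (4 * a) ^ k * ‖x‖ ∧
      ‖pre (mix p θ ω t) x k - pre (mix p θ ω t') x k‖ ≤
        k * (4 * a) ^ k * |t - t'| * ‖x‖ := by
  induction k with
  | zero => simp [pre]
  | succ k ih =>
    obtain ⟨i1, i2⟩ := ih (by omega)
    have hkd : k < d := hk
    have ha0 : 0 ≤ a := (opNorm_nonneg _).trans (ha ⟨k, hkd⟩)
    -- Every point of the segment is a column rescaling of `θ`; the first matrix is not dropped out.
    -- The factors are at most 4 because dropout changes a factor by at most 3.
    let e : ℝ → Fin (h k) → ℝ := fun t c =>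
      if 1 ≤ k then 1 + (1 - t) * drop p (ω ⟨⟨k, hkd⟩, c⟩) else 1
    have he : ∀ t r c, mix p θ ω t ⟨k, hkd⟩ r c = e t c * θ ⟨k, hkd⟩ r c := by
      intro t r c
      by_cases hk1 : 1 ≤ k
      · simp only [e, hk1, if_true]
        exact mix_apply ⟨k, hkd⟩ hk1 r c
      · have : k = 0 := by omega
        subst this
        simp [e, mix_zero]
    have he4 : ∀ t ∈ Icc (0 : ℝ) 1, ∀ c, |e t c| ≤ 4 := by
      intro t ht c
      simp only [e]
      split_ifs
      · have hd := abs_le.1 (abs_drop_le h0 h1 (ω ⟨⟨k, hkd⟩, c⟩))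
        rw [abs_le]
        constructor <;> nlinarith [ht.1, ht.2]
      · norm_num
    have hee : ∀ c, |e t c - e t' c| ≤ 4 * |t - t'| := by
      intro c
      simp only [e]
      split_ifs
      · have hd := abs_drop_le h0 h1 (ω ⟨⟨k, hkd⟩, c⟩)
        rw [show 1 + (1 - t) * drop p (ω ⟨⟨k, hkd⟩, c⟩) -
          (1 + (1 - t') * drop p (ω ⟨⟨k, hkd⟩, c⟩)) =
          -(drop p (ω ⟨⟨k, hkd⟩, c⟩) * (t - t')) by ring, abs_neg, abs_mul]
        exact mul_le_mul_of_nonneg_right (by linarith) (abs_nonneg _)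
      · simp
    have hs : ∀ B : Matrix (Fin (h (k + 1))) (Fin (h k)) ℝ, ∀ e : Fin (h k) → ℝ, ∀ M, 0 ≤ M →
        (∀ c, |e c| ≤ M) → (∀ r c, B r c = e c * θ ⟨k, hkd⟩ r c) → ∀ v, ‖mulE B v‖ ≤
        a * (M * ‖v‖) := fun B e M hM h1 h2 v =>
      (norm_mulE_le_of_scaled hM h1 h2 v).trans
        (mul_le_mul_of_nonneg_right (ha _) (by positivity))
    rw [pre_succ _ x hkd, pre_succ _ x hkd]
    set w := pre (mix p θ ω t) x k
    set w' := pre (mix p θ ω t') x k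
    constructor
    · refine (hs _ _ 4 (by norm_num) (he4 t' ht') (he t') _).trans ?_
      calc _ ≤ a * (4 * ((4 * a) ^ k * ‖x‖)) := by
            gcongr
            exact (norm_act_le _).trans i1
        _ = _ := by ring
    · have hsplit : mulE (mix p θ ω t ⟨k, hkd⟩) (act k w) - mulE (mix p θ ω t' ⟨k, hkd⟩) (act k w')
          = mulE (mix p θ ω t ⟨k, hkd⟩) (act k w - act k w') +
            mulE (mix p θ ω t ⟨k, hkd⟩ - mix p θ ω t' ⟨k, hkd⟩) (act k w') := by
        simp [mulE, Matrix.mulVec_sub, Matrix.sub_mulVec]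
      rw [hsplit]
      have b1 := hs _ _ 4 (by norm_num) (he4 t ht) (he t) (act k w - act k w')
      have b2 := hs (mix p θ ω t ⟨k, hkd⟩ - mix p θ ω t' ⟨k, hkd⟩) _ (4 * |t - t'|) (by positivity)
        hee (fun r c => by rw [Matrix.sub_apply, he, he]; ring) (act k w')
      refine (norm_add_le _ _).trans ((add_le_add b1 b2).trans ?_)
      calc _ ≤ a * (4 * (k * (4 * a) ^ k * |t - t'| * ‖x‖)) +
            a * (4 * |t - t'| * ((4 * a) ^ k * ‖x‖)) := by
            gcongr
            · exact (norm_act_sub_le _ _).trans i2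
            · exact (norm_act_le _).trans i1
        _ = _ := by
            push_cast
            ring

end Lipschitz

/-! ### Existence of a good outcome of dropout -/

section GoodMask

variable {d m : ℕ} {h hstar : ℕ → ℕ} {θ : Params d h} {X : Fin m → E (h 0)}

/-- The cut-off is justified inductively: while the noisy vector is within `3 * Γ ≤ 1` of the clean
one in relative norm, its norm at most doubles, and flatness with the activation contraction bounds
each coordinate. -/
theorem norm_mix_sub_le_of_noise {p K t ρ Γ : ℝ} {ω : Mask d h} {s : Fin m} (hd : 2 ≤ d)
    (hK : 0 < K) (hμ : 0 < minCushion θ X) (ht : t ∈ Icc (0 : ℝ) 1) (hρ : 3 * (d : ℝ) ≤ ρ)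
    (hsm : SmoothAt p ρ θ X ω) (hfl : FlatAt p K θ X ω) (hΓ : 0 ≤ Γ) (hΓ1 : 3 * Γ ≤ 1)
    (hS : ∀ n j, n ≤ j → j ≤ d →
      ‖∑ k ∈ Finset.range n, if 1 ≤ k then fwdDeriv θ (X s) (k + 1) j
        (noise p θ ω (X s) t (fun k => K / √(h k) * (2 * actContraction θ X *
          ‖relu (pre θ (X s) k)‖)) k) else 0‖ ≤ Γ * ‖pre θ (X s) j‖) :
    ‖net (mix p θ ω t) (X s) - net θ (X s)‖ ≤ 3 * Γ * ‖net θ (X s)‖ := by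
  have hne : ∀ i, 1 ≤ i → i ≤ d → pre θ (X s) i ≠ 0 := by
    intro i hi hid
    rcases hi.eq_or_lt with rfl | hi
    · intro h0
      refine (cushion_bounds hμ s le_rfl le_rfl hd).1 ?_
      rw [h0]
      ext j
      simp [relu_apply]
    · exact (cushion_bounds hμ s le_rfl hi hid).2.2.1
  refine norm_pre_sub_le (by omega) hΓ hρ ?_ hne ?_ _ ?_ hS d (by omega) le_rfl
  · rw [pre_succ _ _ (by omega), pre_succ _ _ (by omega), mix_zero]
    rfl
  · rintro k j hk hkj hjd v hv
    obtain ⟨n, rfl⟩ : ∃ n, j = k + 1 + n := ⟨j - (k + 1), by omega⟩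
    rw [← comp_eq_fwd, ← jac_eq_fwdDeriv]
    rcases hv with rfl | rfl
    · have := hsm (k + 1) n (by omega) hjd s t ht (k + 1) (Or.inl rfl)
      rwa [hatX_self] at this
    · have := hsm (k + 1) n (by omega) hjd s t ht k (Or.inr rfl)
      rwa [hatX_pred (by omega)] at this
  · intro k hk hkd hclose
    refine pre_mix_succ_sub hk hkd fun c => ?_
    have hf := hfl k hk (by omega) s t ht c
    rw [hatX_self] at hf
    refine (le_abs_self _).trans (hf.trans ?_)
    refine mul_le_mul_of_nonneg_left ?_ (by positivity)
    have hr := (cushion_bounds hμ s hk le_rfl (by omega : k + 1 ≤ d)).1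
    have hc := norm_pre_le_actContraction s hk hkd hr
    have h1 : ‖pre (mix p θ ω t) (X s) k‖ ≤ 2 * ‖pre θ (X s) k‖ := by
      have := norm_le_norm_add_norm_sub' (pre (mix p θ ω t) (X s) k) (pre θ (X s) k)
      nlinarith [norm_nonneg (pre θ (X s) k)]
    calc _ ≤ ‖pre (mix p θ ω t) (X s) k‖ := norm_relu_le _
      _ ≤ 2 * ‖pre θ (X s) k‖ := h1
      _ ≤ 2 * (actContraction θ X * ‖relu (pre θ (X s) k)‖) := by gcongr
      _ = _ := by ring

/-- There is an outcome of dropout that drops many neurons of every hidden layer and changes the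
network by little at prescribed points of the segment. -/
theorem exists_good_mask {W K K₂ p β ε R Γ : ℝ} (hd : 2 ≤ d) (hK : 0 < K)
    (hK₂ : 0 < K₂) (h0 : 0 < p) (h1 : p ≤ 3 / 4) (hNS : NoiseStable W K p β ε θ X)
    (hw : 0 < minWidth d h) (hcont : 0 < actContraction θ X)
    (hcol : ∀ k : Fin d, 1 ≤ (k : ℕ) → ∀ c, colNorm (θ k) c ≤ K₂ * √p * frob (θ k))
    (hstar_le : ∀ k, 1 ≤ k → k < d → 1.5 * (hstar k : ℝ) ≤ p * h k)
    (hstar_exp : ∀ k, 1 ≤ k → k < d → Real.exp (-(hstar k : ℝ) / 20) ≤ 1 / (8 * d))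
    (N : Finset ℝ) (hN : ∀ t ∈ N, t ∈ Icc (0 : ℝ) 1)
    (hNR : N.card * (m * ((d + 1) * ((d + 1) * Real.exp (1 + d / 4 - R)))) ≤ 1 / 4)
    (hR : 0 ≤ R)
    (hΓ : Γ = 12 * K * (K₂ + 1) * (actContraction θ X * √p / (√(minWidth d h) *
      minCushion θ X)) * R) (hΓ1 : 3 * Γ ≤ 1) :
    ∃ ω : Mask d h, (∀ k (hk : k < d), 1 ≤ k →
        hstar k ≤ (Finset.univ.filter fun c : Fin (h k) => ω ⟨⟨k, hk⟩, c⟩ = true).card) ∧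
      ∀ t ∈ N, ∀ s, ‖net (mix p θ ω t) (X s) - net θ (X s)‖ ≤ 3 * Γ * ‖net θ (X s)‖ := by
  obtain ⟨ρ, hρ, hprob⟩ := hNS.smooth_flat
  have hμ := hNS.cushion_pos
  have hp1 : p ≤ 1 := by linarith
  rw [maskLaw, pi_bitLaw_apply h0.le hp1] at hprob
  have hhalf : 1 / 2 ≤ prob p {ω | SmoothAt p ρ θ X ω ∧ FlatAt p K θ X ω} := by
    rw [ENNReal.le_ofReal_iff_toReal_le (by simp) (prob_nonneg h0.le hp1 _)] at hprob
    simpa using hprob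
  by_contra hcon
  push Not at hcon
  -- The constant 12 is the 2 of the cut-off times the 6 of the normalization in `prob_noise_le`.
  set g : ℝ := 12 * K * (K₂ + 1) * (actContraction θ X * √p / (√(minWidth d h) *
      minCushion θ X)) with hgdef
  have hsw : 0 < √(minWidth d h : ℝ) := Real.sqrt_pos.2 (by exact_mod_cast hw)
  have hsp : 0 < √p := Real.sqrt_pos.2 h0
  have hg : 0 < g := by positivity
  have hΓ0 : 0 ≤ Γ := by rw [hΓ]; positivity
  let T : Fin m → ℕ → ℝ := fun s k => K / √(h k) * (2 * actContraction θ X *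
          ‖relu (pre θ (X s) k)‖)
  let S : Fin m → ℝ → ℕ → (j : ℕ) → Mask d h → E (h j) := fun s t n j ω =>
    ∑ k ∈ Finset.range n, if 1 ≤ k then fwdDeriv θ (X s) (k + 1) j
        (noise p θ ω (X s) t (T s) k) else 0
  let bad : ℝ × Fin m × ℕ × ℕ → Set (Mask d h) := fun z =>
    {ω | 1 ≤ z.2.2.2 ∧ z.2.2.1 ≤ z.2.2.2 ∧
      g * R * ‖pre θ (X z.2.1) z.2.2.2‖ ≤ ‖S z.2.1 z.1 z.2.2.1 z.2.2.2 ω‖}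
  let few : Fin d → Set (Mask d h) := fun k =>
    {ω | 1 ≤ (k : ℕ) ∧ (Finset.univ.filter fun c : Fin (h k) => ω ⟨k, c⟩ = true).card < hstar k}
  let idx : Finset (ℝ × Fin m × ℕ × ℕ) :=
    N ×ˢ Finset.univ ×ˢ Finset.range (d + 1) ×ˢ Finset.range (d + 1)
  have hbad : ∀ z ∈ idx, prob p (bad z) ≤ Real.exp (1 + d / 4 - R) := by
    rintro ⟨t, s, n, j⟩ hz
    simp only [idx, Finset.mem_product, Finset.mem_univ, Finset.mem_range, true_and] at hz
    obtain ⟨htN, hn, hj⟩ := hz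
    by_cases hnj : 1 ≤ j ∧ n ≤ j
    · have hxj : pre θ (X s) j ≠ 0 := by
        rcases hnj.1.eq_or_lt with rfl | hj1
        · intro h0
          refine (cushion_bounds hμ s le_rfl le_rfl hd).1 ?_
          rw [h0]
          ext j
          simp [relu_apply]
        · exact (cushion_bounds hμ s le_rfl hj1 (by omega)).2.2.1
      have := prob_noise_le (θ := θ) (x := X s) (R := R) (T := T s) (n := n) (j := j) h0 h1 hK₂
        (hN t htN) (by omega) hg hxj (fun k => by positivity) hcol
        (fun k hk => (cushion_bounds hμ s hk le_rfl (by omega : (k : ℕ) + 1 ≤ d)).2.1) ?_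
      · refine le_trans (le_of_eq ?_) this
        congr 1
        ext ω
        simp [bad, S, hnj]
      · intro k hk hkn
        have hcb := (cushion_bounds hμ s hk (by omega : (k : ℕ) + 1 ≤ j) (by omega)).2.2.2
        have hwk : √(minWidth d h : ℝ) ≤ √(h k) :=
          Real.sqrt_le_sqrt (by exact_mod_cast minWidth_le hk k.2)
        have hfr : 0 ≤ frob (θ k) := Real.sqrt_nonneg _
        have e1 : g * ‖pre θ (X s) j‖ * (6 * (K₂ + 1) * √p)⁻¹ =
            2 * K * actContraction θ X / √(minWidth d h) *
              (‖pre θ (X s) j‖ / minCushion θ X) := by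
          rw [hgdef]
          field_simp
          norm_num
        have e2 : T s k * ‖fwdDeriv θ (X s) (k + 1) j‖ * frob (θ k) =
            2 * K * actContraction θ X / √(h k) * (‖fwdDeriv θ (X s) (k + 1) j‖ *
              frob (θ k) * ‖relu (pre θ (X s) k)‖) := by
          simp only [T]
          ring
        rw [e1, e2]
        refine mul_le_mul ?_ ((le_div_iff₀ hμ).2 hcb) (by positivity) (by positivity)
        gcongr
    · refine le_trans (le_of_eq ?_) (Real.exp_pos _).le
      have : bad (t, s, n, j) = ∅ := by
        ext ω
        simp only [bad, mem_ofPred_eq, mem_empty_iff_false, iff_false]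
        exact fun hh => hnj ⟨hh.1, hh.2.1⟩
      simp [this, prob, expect]
  have hfew : ∀ k : Fin d, prob p (few k) ≤ 1 / (8 * d) := by
    intro k
    by_cases hk : 1 ≤ (k : ℕ)
    · let Tk : Finset ((k : Fin d) × Fin (h k)) :=
        Finset.univ.map (Function.Embedding.sigmaMk (β := fun k : Fin d => Fin (h k)) k)
      have hc : ∀ ω : Mask d h, (Tk.filter fun c => ω c = true).card =
          (Finset.univ.filter fun c : Fin (h k) => ω ⟨k, c⟩ = true).card := by
        intro ω
        simp only [Tk, Finset.filter_map, Finset.card_map]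
        rfl
      have := prob_card_lt_le h0.le hp1 Tk (hstar k) (by simpa [Tk] using hstar_le k hk k.2)
      refine le_trans (le_of_eq ?_) (this.trans (hstar_exp k hk k.2))
      congr 1
      ext ω
      simp [few, hk, hc]
    · refine le_trans (le_of_eq ?_) (by positivity : (0 : ℝ) ≤ 1 / (8 * d))
      have : few k = ∅ := by
        ext ω
        simp [few, hk]
      simp [this, prob, expect]
  -- If no outcome were good, the stability event would be covered by the events of large noise, of
  -- probability at most 1/4, and of too few dropped neurons, at most 1/8.
  have hsub : prob p {ω | SmoothAt p ρ θ X ω ∧ FlatAt p K θ X ω} ≤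
      ∑ b : Bool, prob p (if b then {ω | ∃ z ∈ idx, ω ∈ bad z} else {ω | ∃ k, ω ∈ few k}) := by
    refine prob_le_sum h0.le hp1 Finset.univ _ fun ω hω => ?_
    by_cases hF : ∃ k, ω ∈ few k
    · exact ⟨false, Finset.mem_univ _, by simpa using hF⟩
    · refine ⟨true, Finset.mem_univ _, ?_⟩
      simp only [if_true, mem_ofPred_eq]
      obtain ⟨t, ht, s, hts⟩ := hcon ω fun k hk hk1 => by
        by_contra hlt
        exact hF ⟨⟨k, hk⟩, hk1, not_le.1 hlt⟩
      by_contra hB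
      push Not at hB
      refine absurd (norm_mix_sub_le_of_noise (s := s) hd hK hμ (hN t ht) hρ hω.1 hω.2 hΓ0 hΓ1
        fun n j hnj hjd => ?_) (not_le.2 hts)
      rcases Nat.eq_zero_or_pos j with rfl | hj
      · have : n = 0 := by omega
        subst this
        simpa using mul_nonneg hΓ0 (norm_nonneg _)
      · have := hB (t, s, n, j) (by
          simp only [idx, Finset.mem_product, Finset.mem_univ, Finset.mem_range, true_and]
          exact ⟨ht, by omega, by omega⟩)
        rw [hΓ]
        by_contra hc
        exact this ⟨hj, hnj, (not_le.1 hc).le⟩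
  have hb1 : prob p {ω | ∃ z ∈ idx, ω ∈ bad z} ≤ 1 / 4 := by
    refine (prob_le_sum h0.le hp1 idx bad fun ω hω => hω).trans
      ((Finset.sum_le_sum hbad).trans (le_trans (le_of_eq ?_) hNR))
    simp [idx, Finset.card_product]
    ring
  have hb2 : prob p {ω | ∃ k, ω ∈ few k} ≤ 1 / 8 := by
    refine (prob_le_sum h0.le hp1 Finset.univ few fun ω hω => by simpa using hω).trans
      ((Finset.sum_le_sum fun k _ => hfew k).trans (le_of_eq ?_))
    have : (d : ℝ) ≠ 0 := by
      have : d ≠ 0 := by omega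
      exact_mod_cast this
    simp
    field_simp
  simp only [Fintype.sum_bool, if_true, Bool.false_eq_true, if_false] at hsub
  linarith

end GoodMask

/-! ### Choice of constants and conclusion -/

section Main

variable {d m : ℕ} {h hstar : ℕ → ℕ}

theorem empLoss_le_add {l : E (h d) → E (h d) → ℝ} {β δ : ℝ} {X : Fin m → E (h 0)}
    {Y : Fin m → E (h d)} {f g : E (h 0) → E (h d)} (hm : 1 ≤ m) (hβ : 0 ≤ β)
    (hl : ∀ y u v, |l y u - l y v| ≤ β * ‖u - v‖)
    (H : ∀ s, ‖f (X s) - g (X s)‖ ≤ δ) : empLoss l X Y f ≤ empLoss l X Y g + β * δ := by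
  have hm0 : (0 : ℝ) < m := by exact_mod_cast hm
  have : ∑ s, l (Y s) (f (X s)) ≤ ∑ s, (l (Y s) (g (X s)) + β * δ) := by
    refine Finset.sum_le_sum fun s _ => ?_
    have h1 := (abs_le.1 (hl (Y s) (f (X s)) (g (X s)))).2
    have h2 := mul_le_mul_of_nonneg_left (H s) hβ
    linarith
  rw [Finset.sum_add_distrib, Finset.sum_const, Finset.card_univ, Fintype.card_fin,
    nsmul_eq_mul] at this
  calc empLoss l X Y f ≤ 1 / (m : ℝ) * (∑ s, l (Y s) (g (X s)) + m * (β * δ)) :=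
        mul_le_mul_of_nonneg_left this (by positivity)
    _ = _ := by
        rw [empLoss]
        field_simp

/-- With `Q = exp Λ` all relevant parameters are at most `Q`, so errors can be counted in powers of
`Q`. -/
theorem exp_logFactor_ge {β ε : ℝ} {θ : Params d h} {X : Fin m → E (h 0)} (hβ : 0 ≤ β)
    (hε : 0 ≤ ε) (hd : 2 ≤ d) (hm : 1 ≤ m) :
    5 ≤ Real.exp (logFactor β ε θ X) ∧ (m : ℝ) ≤ Real.exp (logFactor β ε θ X) ∧
      (d : ℝ) + 1 ≤ Real.exp (logFactor β ε θ X) ∧ β ≤ Real.exp (logFactor β ε θ X) ∧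
      (∀ s, ‖X s‖ ≤ Real.exp (logFactor β ε θ X)) ∧ 1 / ε ≤ Real.exp (logFactor β ε θ X) ∧
      (∀ k, opNorm (θ k) ≤ Real.exp (logFactor β ε θ X)) ∧
      ∀ k : Fin d, (h (k + 1) : ℝ) ≤ Real.exp (logFactor β ε θ X) := by
  have hX : 0 ≤ ⨆ s, ‖X s‖ := Real.iSup_nonneg fun s => norm_nonneg _
  have hterm : ∀ k : Fin d, 0 ≤ (h (k + 1) : ℝ) + opNorm (θ k) := fun k =>
    add_nonneg (Nat.cast_nonneg _) (opNorm_nonneg _)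
  have hsum : 0 ≤ ∑ k : Fin d, ((h (k + 1) : ℝ) + opNorm (θ k)) :=
    Finset.sum_nonneg fun k _ => hterm k
  have hε' : 0 ≤ 1 / ε := by positivity
  have hd' : (2 : ℝ) ≤ d := by exact_mod_cast hd
  have hm' : (1 : ℝ) ≤ m := by exact_mod_cast hm
  have hk : ∀ k : Fin d, (h (k + 1) : ℝ) + opNorm (θ k) ≤
      ∑ k : Fin d, ((h (k + 1) : ℝ) + opNorm (θ k)) := fun k =>
    Finset.single_le_sum (f := fun k : Fin d => (h (k + 1) : ℝ) + opNorm (θ k))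
      (fun k _ => hterm k) (Finset.mem_univ k)
  rw [logFactor, Real.exp_log (by linarith)]
  refine ⟨by linarith, by linarith, by linarith, by linarith, fun s => ?_, by linarith,
    fun k => ?_, fun k => ?_⟩
  · have := le_ciSup (f := fun s => ‖X s‖) (Set.finite_range _).bddAbove s
    linarith
  · have := hk k
    have : (0 : ℝ) ≤ h (k + 1) := Nat.cast_nonneg _
    linarith [hk k]
  · linarith [hk k, opNorm_nonneg (θ k)]

/-- The constant 80 gives `(d + 1) ^ (-4)`, small enough for the union bound over the layers. -/
theorem exp_neg_div_le {w : ℝ} (hd : 2 ≤ d) (hw : 80 * Real.log (d + 1) ≤ w) :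
    Real.exp (-w / 20) ≤ 1 / (8 * d) := by
  have hd' : (2 : ℝ) ≤ d := by exact_mod_cast hd
  have h2 : Real.exp (-w / 20) ≤ Real.exp (-(4 * Real.log (d + 1))) :=
    Real.exp_le_exp.2 (by linarith)
  refine h2.trans ?_
  have e4 : Real.exp (4 * Real.log (d + 1)) = ((d : ℝ) + 1) ^ 4 := by
    rw [← Nat.cast_ofNat, Real.exp_nat_mul, Real.exp_log (by linarith)]
  rw [Real.exp_neg, e4, one_div]
  refine inv_anti₀ (by positivity) ?_
  have : (27 : ℝ) ≤ (d + 1) ^ 3 := by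
    calc (27 : ℝ) = 3 ^ 3 := by norm_num
      _ ≤ _ := pow_le_pow_left₀ (by norm_num) (by linarith) 3
  calc (8 * d : ℝ) ≤ 27 * (d + 1) := by linarith
    _ ≤ (d + 1) ^ 3 * (d + 1) := by gcongr
    _ = _ := by ring

/-- The points `i / M` with `i ≤ M`. -/
def gridPoints (M : ℕ) : Finset ℝ := (Finset.range (M + 1)).image fun i : ℕ => (i : ℝ) / M

theorem gridPoints_subset {M : ℕ} (hM : 0 < M) : ∀ t ∈ gridPoints M, t ∈ Icc (0 : ℝ) 1 := by
  intro t ht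
  obtain ⟨i, hi, rfl⟩ := Finset.mem_image.1 ht
  have : (i : ℝ) ≤ M := by exact_mod_cast Nat.lt_succ_iff.1 (Finset.mem_range.1 hi)
  exact ⟨by positivity, (div_le_one (by exact_mod_cast hM)).2 this⟩

theorem exists_gridPoint_near {M : ℕ} (hM : 0 < M) {t : ℝ} (ht : t ∈ Icc (0 : ℝ) 1) :
    ∃ t' ∈ gridPoints M, |t - t'| ≤ 1 / M := by
  have hM0 : (0 : ℝ) < M := by exact_mod_cast hM
  have htM : 0 ≤ t * M := mul_nonneg ht.1 hM0.le
  have hfl := Nat.floor_le htM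
  have hfl2 := Nat.lt_floor_add_one (t * M)
  have hle : ⌊t * M⌋₊ ≤ M := by
    have : (⌊t * M⌋₊ : ℝ) ≤ M := hfl.trans (by nlinarith [ht.2])
    exact_mod_cast this
  refine ⟨(⌊t * M⌋₊ : ℝ) / M,
    Finset.mem_image.2 ⟨_, Finset.mem_range.2 (Nat.lt_succ_of_le hle), rfl⟩, ?_⟩
  have e2 : t - (⌊t * M⌋₊ : ℝ) / M = (t * M - ⌊t * M⌋₊) / M := by
    field_simp
  rw [e2, abs_of_nonneg (div_nonneg (by linarith) hM0.le)]
  exact div_le_div_of_nonneg_right (by linarith) hM0.le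

/-- Grid, inputs and pairs of layers number at most `Q ^ (2 d + 9)`; the tail is at most `Q ^ (-(2 d
+ 11))`. The summand `d` of the deviation absorbs `1 + d / 4`. -/
theorem union_bound_le {La : ℝ} {M : ℕ} (hd : 2 ≤ d) (hLa : 5 ≤ Real.exp La)
    (hm : (m : ℝ) ≤ Real.exp La) (hd1 : (d : ℝ) + 1 ≤ Real.exp La)
    (hM : (M : ℝ) + 1 ≤ Real.exp La ^ (2 * d + 6)) :
    ((gridPoints M).card : ℝ) * (m * ((d + 1) * ((d + 1) *
      Real.exp (1 + d / 4 - (d + (2 * d + 11) * La))))) ≤ 1 / 4 := by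
  have hd' : (2 : ℝ) ≤ d := by exact_mod_cast hd
  have hcard : ((gridPoints M).card : ℝ) ≤ Real.exp La ^ (2 * d + 6) := by
    refine le_trans ?_ hM
    have := Finset.card_image_le (s := Finset.range (M + 1)) (f := fun i : ℕ => (i : ℝ) / M)
    rw [Finset.card_range] at this
    exact_mod_cast this
  have hexp : Real.exp (1 + d / 4 - (d + (2 * d + 11) * La)) ≤
      (Real.exp La ^ (2 * d + 11))⁻¹ := by
    rw [← Real.exp_nat_mul, ← Real.exp_neg]
    refine Real.exp_le_exp.2 ?_
    push_cast
    linarith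
  generalize Real.exp La = Q at *
  have hQ0 : 0 < Q := by linarith
  calc _ ≤ Q ^ (2 * d + 6) * (Q * (Q * (Q * (Q ^ (2 * d + 11))⁻¹))) := by gcongr
    _ = (Q ^ 2)⁻¹ := by
      field_simp
      ring
    _ ≤ 1 / 4 := by
      rw [one_div]
      exact inv_anti₀ (by norm_num) (by nlinarith)

theorem exists_nat_pow_le {Q : ℝ} (hQ : 5 ≤ Q) (n : ℕ) :
    ∃ M : ℕ, 0 < M ∧ Q ^ n ≤ M ∧ (M : ℝ) + 1 ≤ Q ^ (n + 1) := by
  have h3 : 1 ≤ Q ^ n := one_le_pow₀ (by linarith)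
  have h2 : (⌈Q ^ n⌉₊ : ℝ) < Q ^ n + 1 := Nat.ceil_lt_add_one (by linarith)
  refine ⟨⌈Q ^ n⌉₊, Nat.ceil_pos.2 (by linarith), Nat.le_ceil _, ?_⟩
  rw [pow_succ]
  nlinarith

/-- Since `4 Q ≤ Q ^ 2`, the Lipschitz constant times the norm of the input is at most `Q ^ (2 d +
2)`. -/
theorem lipschitz_error_le {Q a b : ℝ} (hQ : 5 ≤ Q) (hd : (d : ℝ) ≤ Q) (ha : 0 ≤ a)
    (haQ : a ≤ (Q ^ (2 * d + 5))⁻¹) (hb : 0 ≤ b) (hbQ : b ≤ Q) :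
    (d : ℝ) * (4 * Q) ^ d * a * b ≤ (Q ^ 3)⁻¹ := by
  have hQ0 : 0 < Q := by linarith
  calc (d : ℝ) * (4 * Q) ^ d * a * b ≤ Q * (Q * Q) ^ d * (Q ^ (2 * d + 5))⁻¹ * Q := by
        gcongr
        linarith
    _ = (Q ^ 3)⁻¹ := by
        rw [← pow_two, ← pow_mul]
        field_simp
        ring

/-- A noise-stable network can be connected to a network with many dead neurons at a small
cost. -/
theorem exists_dead {l : E (h d) → E (h d) → ℝ} {K K₂ β ε p : ℝ} {X : Fin m → E (h 0)}
    {Y : Fin m → E (h d)} {θ : Params d h} (hK : 0 < K) (hK₂ : 0 < K₂) (hd : 2 ≤ d) (hm : 1 ≤ m)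
    (hl : ∀ y u v, |l y u - l y v| ≤ β * ‖u - v‖)
    (hstar_width : 80 * Real.log (d + 1) ≤ minWidth d hstar)
    (hp : ∀ i, 1 ≤ i → i ≤ d - 1 → 1.5 * ((hstar i : ℝ) / h i) ≤ p) (h1 : p ≤ 3 / 4)
    (hNS : NoiseStable (80 * Real.log (d + 1)) K p β ε θ X)
    (hcol : ∀ k : Fin d, 1 ≤ (k : ℕ) → ∀ c, colNorm (θ k) c ≤ K₂ * √p * frob (θ k)) :
    ∃ (θ' : Params d h) (D : ∀ k, Finset (Fin (h k))),
      LossOn l X Y (empLoss l X Y (net θ) +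
        (324 * K * (K₂ + 1) + 1) * logFactor β ε θ X * (√p * ε)) θ θ' ∧
      (∀ k, 1 ≤ k → k < d → hstar k ≤ (D k).card) ∧
      ∀ k : Fin d, 1 ≤ (k : ℕ) → ∀ r, ∀ j ∈ D k, θ' k r j = 0 := by
  have hd' : (2 : ℝ) ≤ d := by exact_mod_cast hd
  have hlog : 0 < Real.log (d + 1) := Real.log_pos (by linarith)
  have hw : 0 < minWidth d h := by
    have : (0 : ℝ) < minWidth d h := lt_of_lt_of_le (by positivity) hNS.width
    exact_mod_cast this
  have hh : ∀ k, 1 ≤ k → k < d → 0 < h k := fun k hk hkd => hw.trans_le (minWidth_le hk hkd)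
  have hst : ∀ k, 1 ≤ k → k < d → 80 * Real.log (d + 1) ≤ hstar k := fun k hk hkd =>
    hstar_width.trans (by exact_mod_cast minWidth_le hk hkd)
  have hstar_le : ∀ k, 1 ≤ k → k < d → 1.5 * (hstar k : ℝ) ≤ p * h k := by
    intro k hk hkd
    have hk0 : (0 : ℝ) < h k := by exact_mod_cast hh k hk hkd
    have := hp k hk (by omega)
    rwa [← mul_div_assoc, div_le_iff₀ hk0] at this
  have hμ := hNS.cushion_pos
  have hx := fun s => cushion_bounds hμ s le_rfl hd le_rfl
  have s0 : Fin m := ⟨0, hm⟩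
  have hnet : ∀ s, 0 < ‖net θ (X s)‖ := fun s => norm_pos_iff.2 (hx s).2.2.1
  -- The Lipschitz inequality at two distinct points forces this; positive cushions make the output
  -- nonzero.
  have hβ : 0 ≤ β := by
    have := (abs_nonneg _).trans (hl 0 (net θ (X s0)) 0)
    rw [sub_zero] at this
    exact nonneg_of_mul_nonneg_left this (hnet s0)
  have hF : ∀ s, ‖net θ (X s)‖ ≤ ⨆ s, ‖net θ (X s)‖ := fun s =>
    le_ciSup (f := fun s => ‖net θ (X s)‖) (Set.finite_range _).bddAbove s
  have hcp : 0 < actContraction θ X := by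
    have h2 := norm_pre_le_actContraction s0 le_rfl (by omega : 1 < d) (hx s0).1
    have h3 := norm_pos_iff.2 (hx s0).1
    have h4 := norm_relu_le (pre θ (X s0) 1)
    exact pos_of_mul_pos_left (lt_of_lt_of_le (by linarith) h2) h3.le
  have hstab := hNS.number_le
  set c := actContraction θ X with hc
  set μ := minCushion θ X with hμdef
  set F := ⨆ s, ‖net θ (X s)‖ with hFdef
  have hF0 : 0 < F := (hnet s0).trans_le (hF s0)
  have hsw : 0 < √(minWidth d h : ℝ) := Real.sqrt_pos.2 (by exact_mod_cast hw)
  have hε : 0 ≤ ε := by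
    refine le_trans ?_ hstab
    rw [stabilityNumber, ← hc, ← hμdef, ← hFdef]
    positivity
  obtain ⟨q5, qm, qd, qβ, qX, qε, qθ, qh⟩ := exp_logFactor_ge (θ := θ) (X := X) hβ hε hd hm
  set La := logFactor β ε θ X with hLa
  set Q := Real.exp La with hQ
  have hQ0 : 0 < Q := Real.exp_pos _
  have hLa1 : 1 ≤ La := by
    rw [← Real.exp_le_exp]
    linarith [Real.exp_one_lt_d9]
  -- A lower bound for `p`, from `1.5 ≤ p * h 1`, ensures that `√p * ε` dominates the discretization
  -- error.
  have hp0 : 1 / Q ≤ p := by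
    have hst1 : (1 : ℝ) ≤ hstar 1 := by
      have : (0 : ℝ) < hstar 1 := lt_of_lt_of_le (by positivity) (hst 1 le_rfl hd)
      have : 0 < hstar 1 := by exact_mod_cast this
      exact_mod_cast this
    have := hstar_le 1 le_rfl hd
    have hh1 : (0 : ℝ) < h 1 := by exact_mod_cast hh 1 le_rfl hd
    have hq1 : (h 1 : ℝ) ≤ Q := qh ⟨0, by omega⟩
    rw [div_le_iff₀ hQ0]
    have hpp : 0 < p := by
      by_contra hcon
      have := mul_nonpos_of_nonpos_of_nonneg (not_lt.1 hcon) hh1.le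
      linarith
    have := mul_le_mul_of_nonneg_left hq1 hpp.le
    linarith
  have hpp : 0 < p := lt_of_lt_of_le (by positivity) hp0
  have hsp : 0 < √p := Real.sqrt_pos.2 hpp
  have hC0 : 0 < 324 * K * (K₂ + 1) := by positivity
  have herr0 : 0 ≤ La * (√p * ε) := by positivity
  -- If the allowed error exceeds the largest change of loss caused by shrinking the output to zero,
  -- the zero network serves: all its neurons are dead.
  by_cases htriv : β * F ≤ (324 * K * (K₂ + 1) + 1) * La * (√p * ε)
  · refine ⟨0, fun k => Finset.univ, fun u hu => ?_, fun k hk hkd => ?_, fun _ _ _ _ _ => rfl⟩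
    · have hu1 : 0 ≤ 1 - u := by linarith [hu.2]
      refine (empLoss_le_add (g := net θ) (δ := F) hm hβ hl fun s => ?_).trans (by linarith)
      rw [smul_zero, add_zero, net, pre_smul θ (X s) hu1 le_rfl]
      have e : (1 - u) ^ d • pre θ (X s) d - net θ (X s) =
          -((1 - (1 - u) ^ d) • net θ (X s)) := by
        rw [net]
        module
      have hpow : 0 ≤ (1 - u) ^ d := pow_nonneg hu1 d
      have hpow1 : (1 - u) ^ d ≤ 1 := pow_le_one₀ hu1 (by linarith [hu.1])
      rw [e, norm_neg, norm_smul, Real.norm_eq_abs, abs_of_nonneg (by linarith)]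
      exact (mul_le_of_le_one_left (norm_nonneg _) (by linarith)).trans (hF s)
    · have := hstar_le k hk hkd
      have hk0 : (0 : ℝ) < h k := by exact_mod_cast hh k hk hkd
      have : (hstar k : ℝ) ≤ h k := by
        have := mul_le_mul_of_nonneg_right h1 hk0.le
        linarith
      rw [Finset.card_univ, Fintype.card_fin]
      exact_mod_cast this
  rw [not_le] at htriv
  have hβF : 0 < β * F := lt_of_le_of_lt (by positivity) htriv
  have hβ0 : 0 < β := pos_of_mul_pos_left hβF hF0.le
  have hε0 : 0 < ε := by
    refine lt_of_lt_of_le ?_ hstab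
    rw [stabilityNumber, ← hc, ← hμdef, ← hFdef]
    positivity
  set R := (d : ℝ) + (2 * d + 11) * La with hR
  set Γ := 12 * K * (K₂ + 1) * (c * √p / (√(minWidth d h : ℝ) * μ)) * R with hΓ
  have hR9 : R ≤ 9 * d * La := by
    have e1 := mul_le_mul_of_nonneg_right hd' (zero_le_one.trans hLa1)
    have e2 : (d : ℝ) ≤ d * La := le_mul_of_one_le_right (by linarith) hLa1
    rw [hR]
    linarith
  have hR0 : 0 ≤ R := by positivity
  have hΓ0 : 0 ≤ Γ := by positivity
  -- The constant is `324 = 3 * 12 * 9`, with 9 from the bound on `R`.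
  have hΓF : 3 * Γ * (β * F) ≤ 324 * K * (K₂ + 1) * La * (√p * ε) := by
    have hdd : (d : ℝ) ≤ (d : ℝ) ^ (3 / 2 : ℝ) := by
      conv_lhs => rw [← Real.rpow_one (d : ℝ)]
      exact Real.rpow_le_rpow_of_exponent_le (by linarith) (by norm_num)
    calc 3 * Γ * (β * F) ≤ 3 * (12 * K * (K₂ + 1) * (c * √p / (√(minWidth d h : ℝ) * μ)) *
          (9 * d * La)) * (β * F) := by
          rw [hΓ]
          gcongr
      _ = 324 * K * (K₂ + 1) * La * (√p * (β * c * d * F / (√(minWidth d h : ℝ) * μ))) := by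
          ring
      _ ≤ 324 * K * (K₂ + 1) * La *
          (√p * (β * c * (d : ℝ) ^ (3 / 2 : ℝ) * F / (√(minWidth d h : ℝ) * μ))) := by
          gcongr
      _ ≤ _ := by
          gcongr
          exact hstab
  -- Otherwise the previous bound would contradict the negation of `htriv`.
  have hΓ1 : 3 * Γ ≤ 1 := by
    by_contra hcon
    have : 1 * (β * F) ≤ 3 * Γ * (β * F) :=
      mul_le_mul_of_nonneg_right (not_le.1 hcon).le hβF.le
    linarith
  have hQ1 : 1 ≤ Q := by linarith
  obtain ⟨M, hMN, hMge, hMle⟩ := exists_nat_pow_le q5 (2 * d + 5)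
  have hgrid := gridPoints_subset hMN
  have hunion := union_bound_le (m := m) hd q5 qm qd hMle
  obtain ⟨ω, hω1, hω2⟩ := exists_good_mask hd hK hK₂ hpp h1 hNS hw hcp hcol hstar_le
    (fun k hk hkd => exp_neg_div_le hd (hst k hk hkd)) _ hgrid hunion hR0 hΓ hΓ1
  refine ⟨dropUpTo p θ ω d, fun k => if hk : k < d then
    Finset.univ.filter fun c : Fin (h k) => ω ⟨⟨k, hk⟩, c⟩ = true else ∅, ?_, ?_, ?_⟩
  · intro u hu
    have e : (1 - u) • θ + u • dropUpTo p θ ω d = mix p θ ω (1 - u) := by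
      rw [mix, sub_sub_cancel]
    rw [e]
    set t := 1 - u with ht
    have ht01 : t ∈ Icc (0 : ℝ) 1 := ⟨by linarith [hu.2], by linarith [hu.1]⟩
    obtain ⟨t', hmem, htt⟩ := exists_gridPoint_near hMN ht01
    have ht'01 := hgrid t' hmem
    replace htt : |t - t'| ≤ (Q ^ (2 * d + 5))⁻¹ := by
      refine htt.trans ?_
      rw [one_div]
      exact inv_anti₀ (by positivity) hMge
    have hclose : ∀ s, ‖net (mix p θ ω t) (X s) - net θ (X s)‖ ≤ (Q ^ 3)⁻¹ + 3 * Γ * F := by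
      intro s
      have a1 := (norm_pre_mix_sub_le ω (X s) hpp.le h1 ht01 ht'01 qθ le_rfl).2
      have a2 := hω2 t' hmem s
      have a3 : (d : ℝ) * (4 * Q) ^ d * |t - t'| * ‖X s‖ ≤ (Q ^ 3)⁻¹ :=
        lipschitz_error_le q5 (by linarith) (abs_nonneg _) htt (norm_nonneg _) (qX s)
      have a4 : 3 * Γ * ‖net θ (X s)‖ ≤ 3 * Γ * F :=
        mul_le_mul_of_nonneg_left (hF s) (by positivity)
      have := norm_sub_le_norm_sub_add_norm_sub (net (mix p θ ω t) (X s))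
        (net (mix p θ ω t') (X s)) (net θ (X s))
      simp only [net] at *
      linarith
    refine (empLoss_le_add hm hβ hl hclose).trans ?_
    -- One factor `Q` absorbs `β`; the other two are absorbed by `√p` and `ε`, each at least `1 /
    -- Q`. This accounts for the `+ 1` in the constant.
    have b1 : β * (Q ^ 3)⁻¹ ≤ √p * ε := by
      have c1 : 1 / Q ≤ √p := by
        refine hp0.trans (Real.le_sqrt_of_sq_le ?_)
        rw [sq]
        exact mul_le_of_le_one_left hpp.le (by linarith)
      have c2 : 1 / Q ≤ ε := by
        rw [div_le_iff₀ hε0] at qε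
        rw [div_le_iff₀ hQ0]
        linarith
      calc β * (Q ^ 3)⁻¹ ≤ Q * (Q ^ 3)⁻¹ := by gcongr
        _ = 1 / Q * (1 / Q) := by field_simp
        _ ≤ _ := by gcongr
    have b2 : √p * ε ≤ La * (√p * ε) := le_mul_of_one_le_left (by positivity) hLa1
    have e1 : β * ((Q ^ 3)⁻¹ + 3 * Γ * F) = β * (Q ^ 3)⁻¹ + 3 * Γ * (β * F) := by ring
    have e2 : (324 * K * (K₂ + 1) + 1) * La * (√p * ε) =
        324 * K * (K₂ + 1) * La * (√p * ε) + La * (√p * ε) := by ring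
    linarith
  · intro k hk hkd
    simp only [hkd, dif_pos]
    exact hω1 k hkd hk
  · intro k hk r j hj
    simp only [k.2, dif_pos, Finset.mem_filter, Finset.mem_univ, true_and] at hj
    have hj' : ω ⟨k, j⟩ = true := hj
    have : 2 ≤ (k : ℕ) + 1 ∧ (k : ℕ) + 1 ≤ d := ⟨by omega, k.2⟩
    simp [dropUpTo, this, dropLayer, hj']

end Main

end DeepNet

end

/-- The hidden constants `K₁` (flatness) and `K₂` (column balance) determine the constants and
exponents `C₀, k₀` (width bound) and `C, k` (error bound), uniformly in everything else. -/
theorem theorem3 (K₁ K₂ : ℝ) (hK₁ : 0 < K₁) (hK₂ : 0 < K₂) :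
    ∃ (C₀ C : ℝ) (k₀ k : ℕ), 0 < C₀ ∧ 0 < C ∧
      ∀ (d m : ℕ) (h hstar : ℕ → ℕ) (hin : hstar 0 = h 0) (hout : hstar d = h d)
        (l : DeepNet.E (h d) → DeepNet.E (h d) → ℝ) (β ε p : ℝ)
        (X : Fin m → DeepNet.E (h 0)) (Y : Fin m → DeepNet.E (h d))
        (θA θB : DeepNet.Params d h) (θstar : DeepNet.Params d hstar),
        2 ≤ d → 1 ≤ m →
        (∀ y, ConvexOn ℝ Set.univ (l y)) →
        (∀ y u v, |l y u - l y v| ≤ β * ‖u - v‖) →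
        C₀ * Real.log (d + 1) ^ k₀ ≤ DeepNet.minWidth d hstar →
        (∀ i, 1 ≤ i → i ≤ d - 1 → 1.5 * ((hstar i : ℝ) / h i) ≤ p) → p ≤ 3 / 4 →
        DeepNet.NoiseStable (C₀ * Real.log (d + 1) ^ k₀) K₁ p β ε θA X →
        DeepNet.NoiseStable (C₀ * Real.log (d + 1) ^ k₀) K₁ p β ε θB X →
        (∀ i : Fin d, 1 ≤ (i : ℕ) → ∀ j : Fin (h i),
          DeepNet.colNorm (θA i) j ≤ K₂ * √p * DeepNet.frob (θA i) ∧
          DeepNet.colNorm (θB i) j ≤ K₂ * √p * DeepNet.frob (θB i)) →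
        ∃ γ : Path θA θB, DeepNet.HasSegments 13 γ ∧
          ∀ t, DeepNet.empLoss l X Y (DeepNet.net (γ t)) ≤
            max (max
              (DeepNet.empLoss l X Y (DeepNet.net θA) +
                C * DeepNet.logFactor β ε θA X ^ k * (√p * ε))
              (DeepNet.empLoss l X Y (DeepNet.net θB) +
                C * DeepNet.logFactor β ε θB X ^ k * (√p * ε)))
              (DeepNet.empLoss l X Y fun x =>
                DeepNet.castE hout (DeepNet.net θstar (DeepNet.castE hin.symm x))) := by
  refine ⟨80, 324 * K₁ * (K₂ + 1) + 1, 1, 1, by norm_num, by positivity, ?_⟩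
  intro d m h hstar hin hout l β ε p X Y θA θB θstar hd hm hconv hlip hW hp hp1 hA hB hcol
  simp only [pow_one] at hW hA hB ⊢
  obtain ⟨θA', DA, a1, a2, a3⟩ := DeepNet.exists_dead (hstar := hstar) (Y := Y) hK₁ hK₂ hd hm hlip
    hW hp hp1 hA fun k hk c => (hcol k hk c).1
  obtain ⟨θB', DB, b1, b2, b3⟩ := DeepNet.exists_dead (hstar := hstar) (Y := Y) hK₁ hK₂ hd hm hlip
    hW hp hp1 hB fun k hk c => (hcol k hk c).2
  exact DeepNet.exists_path_of_dead hin hout hconv hd DA DB a2 b2 a3 b3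
    (a1.mono ((le_max_left _ _).trans (le_max_left _ _)))
    (b1.mono ((le_max_right _ _).trans (le_max_left _ _))) (le_max_right _ _)
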